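/- Corollary 4.1 (U-min version). Let $m\ge 2$ be an integer and let $f:(S^1)^m\to\mathbb R\cup\{-\infty,+\infty\}$ be a kernel on the unit circle $S^1$ such that: (A1) $f$ is invariant under rotations, i.e. $f(U_1,\dots,U_m)=h(\beta_1,\dots,\beta_{m-1})$, where $\beta_i\in[0,2\pi)$ is the counterclockwise angle from $U_1$ to $U_{i+1}$; (A2) $f$ is invariant under permutations of its arguments; (A3) $h$ is continuous on $[0,2\pi)^{m-1}$ and extends to a continuous function $h:[0,2\pi]^{m-1}\to\mathbb R\cup\{-\infty,+\infty\}$; (A4) $h$ attains its minimum $\mu\in\mathbb R$ on $[0,2\pi]^{m-1}$ at exactly finitely many points $V_1,\dots,V_k$ (pairwise distinct), and all of them lie in $(0,2\pi)^{m-1}$; (A5) for some $\delta>0$, $h$ is finite and three times continuously differentiable in the $\delta$-neighbourhood of every $V_i$; (A6) the Hessian matrix $G_i=\left(\frac{\partial^2 h}{\partial x_a\partial x_b}(V_i)\right)_{1\le a,b\le m-1}$ satisfies $\det(G_i)\neq0$ for every $i=1,\dots,k$. Let $U_1,U_2,\dots$ be independent random points on $S^1$ whose polar angles have a common density $p$ with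 the following properties: (B2) $p:\mathbb R\to[0,\infty)$ is continuous and $2\pi$-periodic, with $\int_0^{2\pi}p(x)\,dx=1$; (B3) $\int_0^{2\pi}p(x)\prod_{l=1}^{m-1}p(x+V_i^l)\,dx\neq0$ for at least one $i$, where $V_i^l$ is the $l$-th coordinate of $V_i$. Let $H_n=\min_{1\le i_1<\dots<i_m\le n}f(U_{i_1},\dots,U_{i_m})$. Then for every $t>0$ $$\lim_{n\to\infty}\mathbb P\left\{n^{\frac{2m}{m-1}}(H_n-\mu)\le t\right\}=1-\exp\left(-\frac{t^{\frac{m-1}{2}}K}{m!}\right),$$ where $$K=\frac{(2\pi)^{\frac{m-1}{2}}}{\Gamma\left(\frac{m+1}{2}\right)}\sum_{i=1}^k\left(\frac{1}{\sqrt{\det(G_i)}}\int_0^{2\pi}p(x)\prod_{l=1}^{m-1}p(x+V_i^l)\,dx\right).$$ -/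

import Mathlib

open MeasureTheory ProbabilityTheory Filter Topology

noncomputable section

/-- The central angles `β₁, …, β_{m-1} ∈ [0, 2π)` of `m = d + 1` points `u₀, …, u_d` on the unit
circle: `βᵢ` is the counterclockwise angle from `u₀` to `uᵢ`. -/
def centralAngle {d : ℕ} (u : Fin (d + 1) → Circle) (i : Fin d) : ℝ :=
  toIcoMod Real.two_pi_pos 0 (Complex.arg ((u i.succ / u 0 : Circle) : ℂ))

/-- The closed cube `[0, 2π]^d`. -/
def angleCube (d : ℕ) : Set (Fin d → ℝ) := {x | ∀ l, x l ∈ Set.Icc 0 (2 * Real.pi)}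

/-- The matrix of second partial derivatives `∂²g / ∂x_a ∂x_b` at the point `v`. -/
def hessianMatrix {d : ℕ} (g : (Fin d → ℝ) → ℝ) (v : Fin d → ℝ) : Matrix (Fin d) (Fin d) ℝ :=
  Matrix.of fun a b =>
    fderiv ℝ (fun y => fderiv ℝ g y (Pi.single b 1)) v (Pi.single a 1)

/-- The unit circle carries its Borel σ-algebra. -/
instance circleMeasurableSpace : MeasurableSpace Circle := borel Circle

instance circleBorelSpace : BorelSpace Circle := ⟨rfl⟩

/-- The distribution on the unit circle with density `p` with respect to arc length, where a point
of the circle is described by its polar angle `x ∈ [0, 2π)`. -/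
def circleLaw (p : ℝ → ℝ) : Measure Circle :=
  (((volume : Measure ℝ).restrict (Set.Ico 0 (2 * Real.pi))).withDensity
    (fun x => ENNReal.ofReal (p x))).map Circle.exp

/-- `∫₀^{2π} p(x) ∏ₗ p(x + vˡ) dx`. -/
def shiftIntegral {d : ℕ} (p : ℝ → ℝ) (v : Fin d → ℝ) : ℝ :=
  ∫ x in (0 : ℝ)..(2 * Real.pi), p x * ∏ l, p (x + v l)

/-- The U-min statistic `min f(u_{i₁}, …, u_{i_m})` over `i₁ < ⋯ < i_m` among the first `n` members
of the sequence `u`, where `m = d + 1` (it is `⊤` if `n < m`, where there is no such choice). -/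
def uMin {d : ℕ} (f : (Fin (d + 1) → Circle) → EReal) (n : ℕ) (u : ℕ → Circle) : EReal :=
  ⨅ e : Fin (d + 1) ↪o Fin n, f (fun j => u (e j))

/-- `K = (2π)^{(m-1)/2} / Γ((m+1)/2) · ∑_{v ∈ V} det(G_v)^{-1/2} ∫₀^{2π} p(x) ∏ₗ p(x + vˡ) dx`, where
`m = d + 1` and `G_v` is the Hessian matrix of `g` at `v`. -/
def limitConstant {d : ℕ} (g : (Fin d → ℝ) → ℝ) (V : Finset (Fin d → ℝ)) (p : ℝ → ℝ) : ℝ :=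
  (2 * Real.pi) ^ ((d : ℝ) / 2) / Real.Gamma (((d : ℝ) + 2) / 2) *
    ∑ v ∈ V, 1 / √(hessianMatrix g v).det * shiftIntegral p v

end

/-! Write d = m - 1 and s = √t · n^{-m/d}, so that s² = t · n^{-2m/d}. The event in question says
that some selection of m indices has its central angles in the sublevel set {h ≤ μ + s²}. The minima
are interior and nondegenerate, so for small s this set splits into disjoint near-ellipsoids of
radius O(s) around the points of `V`. The central angles have the continuous density `shiftIntegral
p`, and rescaling by s shows that a single selection succeeds with probability (`limitConstant` +
o(1)) s^d: this is `tendsto_setIntegral_angleSublevel`, which rests on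
`tendsto_setIntegral_sublevel` and `Matrix.PosDef.volume_ellipsoid`. Since n^m s^d = t^{d/2}, the
expected number of successes tends to t^{d/2} · `limitConstant` / m!.

It remains to see that the probability of no success is close to exp(-mean). Selections without a
common index are independent, so `abs_measure_avoid_sub_exp_le` applies, with an error governed by
overlapping selections. If a selection succeeds, symmetry of f forces every angle between two of its
points to lie within O(s) of finitely many values (`circleAngle_mem_closeAngles`). Some other sample
point lies at such an angle from a given one with probability O(n s). The error is therefore the
mean times O(n s) = O(n^{-1/d}), which vanishes. -/

/-! ### Poisson approximation for dissociated events, by interpolation. -/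

section PoissonApproximation

variable {Ω ι : Type*}

theorem indicator_one_mem_Icc (E : Set Ω) (ω : Ω) :
    E.indicator (1 : Ω → ℝ) ω ∈ Set.Icc (0 : ℝ) 1 := by
  by_cases h : ω ∈ E <;> simp [h]

theorem one_sub_mul_indicator_mem_Icc (E : Set Ω) {s : ℝ} (hs : s ∈ Set.Icc (0 : ℝ) 1) (ω : Ω) :
    1 - s * E.indicator (1 : Ω → ℝ) ω ∈ Set.Icc (0 : ℝ) 1 := by
  by_cases h : ω ∈ E <;> simp [h, hs.1, hs.2]

/-- The product of the factors `1 - s 1_E` over a finite family of events. -/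
noncomputable def avoidProd (E : ι → Set Ω) (T : Finset ι) (s : ℝ) (ω : Ω) : ℝ :=
  ∏ β ∈ T, (1 - s * (E β).indicator (1 : Ω → ℝ) ω)

theorem avoidProd_mem_Icc (E : ι → Set Ω) (T : Finset ι) {s : ℝ} (hs : s ∈ Set.Icc (0 : ℝ) 1)
    (ω : Ω) : avoidProd E T s ω ∈ Set.Icc (0 : ℝ) 1 :=
  ⟨Finset.prod_nonneg fun β _ => (one_sub_mul_indicator_mem_Icc (E β) hs ω).1,
    Finset.prod_le_one (fun β _ => (one_sub_mul_indicator_mem_Icc (E β) hs ω).1)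
      fun β _ => (one_sub_mul_indicator_mem_Icc (E β) hs ω).2⟩

theorem avoidProd_eq_one {E : ι → Set Ω} {T : Finset ι} {s : ℝ} {ω : Ω}
    (h : ∀ β ∈ T, ω ∉ E β) : avoidProd E T s ω = 1 :=
  Finset.prod_eq_one fun β hβ => by simp [h β hβ]

theorem avoidProd_one (E : ι → Set Ω) (T : Finset ι) :
    avoidProd E T 1 = (⋃ β ∈ T, E β)ᶜ.indicator 1 := by
  ext ω
  by_cases h : ∃ β ∈ T, ω ∈ E β
  · obtain ⟨β, hβ, hω⟩ := h
    rw [Set.indicator_of_notMem]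
    · exact Finset.prod_eq_zero hβ (by simp [hω])
    · simpa using ⟨β, hβ, hω⟩
  · push Not at h
    rw [avoidProd_eq_one h, Set.indicator_of_mem]
    · rfl
    · simpa using h

/-- Dominating bound for differentiation under the integral: a unit neighbourhood of a point of [0,
1] lies in |s| ≤ 2, where each factor is at most 1 + 2. -/
theorem abs_avoidProd_sub_le_of_abs_le {E : ι → Set Ω} {T : Finset ι} {s : ℝ} (hs : |s| ≤ 2)
    (ω : Ω) : |avoidProd E T s ω| ≤ 3 ^ T.card := by
  rw [avoidProd, Finset.abs_prod]
  rw [← Finset.prod_const]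
  refine Finset.prod_le_prod (fun β _ => abs_nonneg _) fun β _ => ?_
  have := indicator_one_mem_Icc (E β) ω
  calc _ ≤ |(1 : ℝ)| + |s * (E β).indicator (1 : Ω → ℝ) ω| := abs_sub _ _
    _ ≤ 1 + 2 * 1 := by
      rw [abs_one, abs_mul, abs_of_nonneg this.1]
      gcongr
      exacts [this.1, this.2]
    _ = 3 := by norm_num

theorem hasDerivAt_avoidProd [DecidableEq ι] (E : ι → Set Ω) (T : Finset ι) (s : ℝ) (ω : Ω) :
    HasDerivAt (fun s => avoidProd E T s ω)
      (-∑ α ∈ T, (E α).indicator (1 : Ω → ℝ) ω * avoidProd E (T.erase α) s ω) s := by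
  have := HasDerivAt.fun_finsetProd (u := T)
    (f := fun β s => 1 - s * (E β).indicator (1 : Ω → ℝ) ω)
    (f' := fun β => -(E β).indicator (1 : Ω → ℝ) ω) (x := s)
    fun β _ => by simpa using ((hasDerivAt_id s).mul_const _).const_sub (1 : ℝ)
  convert! this using 1
  rw [← Finset.sum_neg_distrib]
  refine Finset.sum_congr rfl fun β _ => ?_
  simp [avoidProd, mul_comm]

variable [MeasurableSpace Ω]

theorem measurable_avoidProd {E : ι → Set Ω} (hE : ∀ β, MeasurableSet (E β)) (T : Finset ι)
    (s : ℝ) : Measurable (avoidProd E T s) :=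
  Finset.measurable_prod _ fun β _ =>
    measurable_const.sub ((measurable_one.indicator (hE β)).const_mul s)

theorem integrable_of_abs_le_const {P : Measure Ω} [IsFiniteMeasure P] {g : Ω → ℝ}
    (hg : Measurable g) {C : ℝ} (h : ∀ ω, |g ω| ≤ C) : Integrable g P :=
  Integrable.of_bound hg.aestronglyMeasurable C (Eventually.of_forall h)

theorem hasDerivAt_integral_avoidProd [DecidableEq ι] {P : Measure Ω} [IsProbabilityMeasure P]
    {E : ι → Set Ω} (hE : ∀ β, MeasurableSet (E β)) (T : Finset ι) {s : ℝ}
    (hs : s ∈ Set.Icc (0 : ℝ) 1) :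
    HasDerivAt (fun s => ∫ ω, avoidProd E T s ω ∂P)
      (-∑ α ∈ T, ∫ ω, (E α).indicator (1 : Ω → ℝ) ω * avoidProd E (T.erase α) s ω ∂P) s := by
  have hmeas : ∀ α s, Measurable fun ω =>
      (E α).indicator (1 : Ω → ℝ) ω * avoidProd E (T.erase α) s ω := fun α s =>
    (measurable_one.indicator (hE α)).mul (measurable_avoidProd hE _ s)
  have hbound : ∀ α ∈ T, ∀ s : ℝ, |s| ≤ 2 → ∀ ω,
      |(E α).indicator (1 : Ω → ℝ) ω * avoidProd E (T.erase α) s ω| ≤ 3 ^ T.card := by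
    intro α hα s hs ω
    have h1 := indicator_one_mem_Icc (E α) ω
    rw [abs_mul, abs_of_nonneg h1.1]
    calc _ ≤ 1 * |avoidProd E (T.erase α) s ω| := by gcongr; exact h1.2
      _ ≤ 3 ^ (T.erase α).card := by
        rw [one_mul]; exact abs_avoidProd_sub_le_of_abs_le hs ω
      _ ≤ _ := by gcongr; norm_num; exact Finset.erase_subset _ _
  have key := hasDerivAt_integral_of_dominated_loc_of_deriv_le (μ := P) (𝕜 := ℝ)
    (F := fun s ω => avoidProd E T s ω) (x₀ := s) (s := Metric.ball s 1)
    (F' := fun s ω => -∑ α ∈ T, (E α).indicator (1 : Ω → ℝ) ω * avoidProd E (T.erase α) s ω)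
    (bound := fun _ => T.card * 3 ^ T.card) (Metric.ball_mem_nhds s one_pos)
    (Eventually.of_forall fun s => (measurable_avoidProd hE T s).aestronglyMeasurable)
    (integrable_of_abs_le_const (measurable_avoidProd hE T s) (C := 1) fun ω => by
      rw [abs_of_nonneg (avoidProd_mem_Icc E T hs ω).1]; exact (avoidProd_mem_Icc E T hs ω).2)
    (Finset.measurable_sum _ fun α _ => hmeas α s).neg.aestronglyMeasurable
    (Eventually.of_forall fun ω x hx => ?_) (integrable_const _)
    (Eventually.of_forall fun ω x _ => hasDerivAt_avoidProd E T x ω)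
  · convert! key.2 using 1
    rw [integral_neg, integral_finsetSum]
    exact fun α hα => integrable_of_abs_le_const (hmeas α s)
      (hbound α hα s (by rw [abs_of_nonneg hs.1]; linarith [hs.2]))
  · have hx2 : |x| ≤ 2 := by
      rw [Metric.mem_ball, Real.dist_eq, abs_lt] at hx
      rw [abs_le]; constructor <;> linarith [hs.1, hs.2, hx.1, hx.2]
    rw [norm_neg, Real.norm_eq_abs]
    refine (Finset.abs_sum_le_sum_abs _ _).trans ?_
    exact (Finset.sum_le_sum fun α hα => hbound α hα x hx2 ω).trans_eq (by simp)

/-- Integrals of functions which differ by at most the indicator of an event. -/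
theorem abs_integral_sub_integral_le {P : Measure Ω} [IsProbabilityMeasure P] {g₁ g₂ : Ω → ℝ}
    (h₁ : Integrable g₁ P) (h₂ : Integrable g₂ P) {B : Set Ω} (hB : MeasurableSet B)
    (h : ∀ ω, |g₁ ω - g₂ ω| ≤ B.indicator 1 ω) :
    |∫ ω, g₁ ω ∂P - ∫ ω, g₂ ω ∂P| ≤ P.real B := by
  rw [← integral_sub h₁ h₂, ← integral_indicator_one hB]
  exact (abs_integral_le_integral_abs).trans
    (integral_mono (h₁.sub h₂).abs ((integrable_const 1).indicator hB) h)

/-- Poisson approximation for dissociated events: if each `E α` is independent of the family of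
events outside its neighbourhood `near α`, the probability that no event occurs is close to
`exp (-∑ P (E α))`. -/
theorem abs_measure_avoid_sub_exp_le [Fintype ι] [DecidableEq ι] {P : Measure Ω}
    [IsProbabilityMeasure P] {E : ι → Set Ω} (hE : ∀ α, MeasurableSet (E α))
    (near : ι → Finset ι) (hself : ∀ α, α ∈ near α)
    (hind : ∀ α, IndepFun ((E α).indicator (1 : Ω → ℝ))
      (fun ω (β : {β // β ∉ near α}) => (E β).indicator (1 : Ω → ℝ) ω) P) :
    |P.real (⋃ α, E α)ᶜ - Real.exp (-∑ α, P.real (E α))| ≤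
      ∑ α, (P.real (E α ∩ ⋃ β ∈ (near α).erase α, E β) +
        P.real (E α) * P.real (⋃ β ∈ near α, E β)) := by
  set D := ∑ α, (P.real (E α ∩ ⋃ β ∈ (near α).erase α, E β) +
        P.real (E α) * P.real (⋃ β ∈ near α, E β)) with hD
  set Λ := ∑ α, P.real (E α) with hΛ
  have hD0 : 0 ≤ D := Finset.sum_nonneg fun α _ => by positivity
  have hΛ0 : 0 ≤ Λ := Finset.sum_nonneg fun α _ => by positivity
  have hint : ∀ (T : Finset ι) {s : ℝ}, s ∈ Set.Icc (0 : ℝ) 1 →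
      Integrable (avoidProd E T s) P := fun T s hs =>
    integrable_of_abs_le_const (measurable_avoidProd hE T s) (C := 1) fun ω => by
      rw [abs_of_nonneg (avoidProd_mem_Icc E T hs ω).1]; exact (avoidProd_mem_Icc E T hs ω).2
  have hint' : ∀ (α : ι) (T : Finset ι) {s : ℝ}, s ∈ Set.Icc (0 : ℝ) 1 →
      Integrable (fun ω => (E α).indicator (1 : Ω → ℝ) ω * avoidProd E T s ω) P :=
    fun α T s hs => by
      refine integrable_of_abs_le_const (C := 1)
        ((measurable_one.indicator (hE α)).mul (measurable_avoidProd hE T s)) fun ω => ?_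
      have h1 := indicator_one_mem_Icc (E α) ω
      have h2 := avoidProd_mem_Icc E T hs ω
      rw [abs_of_nonneg (mul_nonneg h1.1 h2.1)]
      exact mul_le_one₀ h1.2 h2.1 h2.2
  have hsplit : ∀ α s ω, avoidProd E Finset.univ s ω =
      avoidProd E (near α) s ω * avoidProd E (near α)ᶜ s ω := fun α s ω =>
    (Finset.prod_mul_prod_compl (near α) _).symm
  have hsplit' : ∀ α s ω, avoidProd E (Finset.univ.erase α) s ω =
      avoidProd E ((near α).erase α) s ω * avoidProd E (near α)ᶜ s ω := by
    intro α s ω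
    have : Finset.univ.erase α = (near α).erase α ∪ (near α)ᶜ := by
      ext β
      by_cases hβ : β = α
      · subst hβ; simp [hself β]
      · simp [hβ, em]
    rw [avoidProd, this, Finset.prod_union]
    · rfl
    · exact disjoint_compl_right.mono_left (Finset.erase_subset _ _)
  -- Three moves: on `E α`, dropping the factors near α matters only if another neighbour occurs;
  -- the remaining far product is independent of `E α`; restoring the near factors matters only if
  -- some event near α occurs.
  have hterm : ∀ α, ∀ s ∈ Set.Icc (0 : ℝ) 1,
      |∫ ω, (E α).indicator (1 : Ω → ℝ) ω * avoidProd E (Finset.univ.erase α) s ω ∂P -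
        P.real (E α) * ∫ ω, avoidProd E Finset.univ s ω ∂P| ≤
      P.real (E α ∩ ⋃ β ∈ (near α).erase α, E β) +
        P.real (E α) * P.real (⋃ β ∈ near α, E β) := by
    intro α s hs
    have hB : ∀ T : Finset ι, MeasurableSet (⋃ β ∈ T, E β) := fun T =>
      T.measurableSet_biUnion fun β _ => hE β
    have h1 : |∫ ω, (E α).indicator (1 : Ω → ℝ) ω * avoidProd E (Finset.univ.erase α) s ω ∂P -
        ∫ ω, (E α).indicator (1 : Ω → ℝ) ω * avoidProd E (near α)ᶜ s ω ∂P| ≤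
        P.real (E α ∩ ⋃ β ∈ (near α).erase α, E β) := by
      refine abs_integral_sub_integral_le (hint' _ _ hs) (hint' _ _ hs)
        ((hE α).inter (hB _)) fun ω => ?_
      by_cases hω : ω ∈ E α ∩ ⋃ β ∈ (near α).erase α, E β
      · have h2 := avoidProd_mem_Icc E (Finset.univ.erase α) hs ω
        have h3 := avoidProd_mem_Icc E (near α)ᶜ hs ω
        rw [Set.indicator_of_mem hω, Set.indicator_of_mem hω.1]
        simp only [Pi.one_apply, one_mul]
        rw [abs_le]; constructor <;> linarith [h2.1, h2.2, h3.1, h3.2]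
      · rw [Set.indicator_of_notMem hω]
        by_cases hα : ω ∈ E α
        · have : ∀ β ∈ (near α).erase α, ω ∉ E β := by
            intro β hβ hωβ
            exact hω ⟨hα, Set.mem_biUnion hβ hωβ⟩
          simp [hsplit', avoidProd_eq_one this]
        · simp [hα]
    have h2 : ∫ ω, (E α).indicator (1 : Ω → ℝ) ω * avoidProd E (near α)ᶜ s ω ∂P =
        P.real (E α) * ∫ ω, avoidProd E (near α)ᶜ s ω ∂P := by
      rw [← integral_indicator_one (hE α)]
      have hfar : avoidProd E (near α)ᶜ s =
          (fun x : {β // β ∉ near α} → ℝ => ∏ β, (1 - s * x β)) ∘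
            (fun ω (β : {β // β ∉ near α}) => (E β).indicator (1 : Ω → ℝ) ω) := by
        ext ω
        simp only [avoidProd, Function.comp_apply]
        exact Finset.prod_subtype (near α)ᶜ (by simp) _
      have := (hind α).comp (φ := id) (ψ := fun x : {β // β ∉ near α} → ℝ => ∏ β, (1 - s * x β))
        measurable_id (by fun_prop)
      rw [← hfar] at this
      exact this.integral_fun_mul_eq_mul_integral
        (measurable_one.indicator (hE α)).aestronglyMeasurable
        (measurable_avoidProd hE _ s).aestronglyMeasurable
    have h3 : |∫ ω, avoidProd E (near α)ᶜ s ω ∂P - ∫ ω, avoidProd E Finset.univ s ω ∂P| ≤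
        P.real (⋃ β ∈ near α, E β) := by
      refine abs_integral_sub_integral_le (hint _ hs) (hint _ hs) (hB _) fun ω => ?_
      by_cases hω : ω ∈ ⋃ β ∈ near α, E β
      · have h2 := avoidProd_mem_Icc E Finset.univ hs ω
        have h3 := avoidProd_mem_Icc E (near α)ᶜ hs ω
        rw [Set.indicator_of_mem hω, Pi.one_apply, abs_le]
        constructor <;> linarith [h2.1, h2.2, h3.1, h3.2]
      · rw [Set.indicator_of_notMem hω]
        have : ∀ β ∈ near α, ω ∉ E β := fun β hβ hωβ => hω (Set.mem_biUnion hβ hωβ)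
        simp [hsplit α, avoidProd_eq_one this]
    rw [h2] at h1
    calc _ ≤ _ := abs_sub_le _ (P.real (E α) * ∫ ω, avoidProd E (near α)ᶜ s ω ∂P) _
      _ ≤ _ := by
        rw [← mul_sub, abs_mul, abs_of_nonneg (measureReal_nonneg (μ := P) (s := E α))]
        gcongr
  -- φ interpolates between 1 at s = 0 and the probability of no event at s = 1. By `hterm`, φ' =
  -- -Λφ up to an error of size D, so the integrating factor e^{Λs} makes e^{Λs} φ(s) vary by at
  -- most e^Λ D.
  set φ : ℝ → ℝ := fun s => ∫ ω, avoidProd E Finset.univ s ω ∂P with hφ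
  have hφ0 : φ 0 = 1 := by simp [hφ, avoidProd]
  have hφ1 : φ 1 = P.real (⋃ α, E α)ᶜ := by
    simp only [hφ, avoidProd_one]
    rw [integral_indicator_one]
    · simp
    · exact (Finset.measurableSet_biUnion _ fun β _ => hE β).compl
  have hderiv : ∀ s ∈ Set.Icc (0 : ℝ) 1, HasDerivWithinAt (fun s => Real.exp (Λ * s) * φ s)
      (Real.exp (Λ * s) * (Λ * φ s - ∑ α, ∫ ω, (E α).indicator (1 : Ω → ℝ) ω *
        avoidProd E (Finset.univ.erase α) s ω ∂P)) (Set.Icc 0 1) s := by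
    intro s hs
    have h1 : HasDerivAt (fun s => Real.exp (Λ * s)) (Real.exp (Λ * s) * Λ) s := by
      simpa using ((hasDerivAt_id s).const_mul Λ).exp
    have := (h1.mul (hasDerivAt_integral_avoidProd (P := P) hE Finset.univ hs)).hasDerivWithinAt
      (s := Set.Icc 0 1)
    convert! this using 1
    ring
  have hbd : ∀ s ∈ Set.Ico (0 : ℝ) 1, ‖Real.exp (Λ * s) * (Λ * φ s - ∑ α, ∫ ω,
      (E α).indicator (1 : Ω → ℝ) ω * avoidProd E (Finset.univ.erase α) s ω ∂P)‖ ≤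
      Real.exp Λ * D := by
    intro s hs
    rw [norm_mul, Real.norm_eq_abs, Real.abs_exp, Real.norm_eq_abs]
    gcongr
    · nlinarith [hs.2]
    · rw [hΛ, Finset.sum_mul, ← Finset.sum_sub_distrib]
      refine (Finset.abs_sum_le_sum_abs _ _).trans (Finset.sum_le_sum fun α _ => ?_)
      rw [abs_sub_comm]
      exact hterm α s ⟨hs.1, hs.2.le⟩
  have hfin := norm_image_sub_le_of_norm_deriv_le_segment_01' hderiv hbd
  simp only [mul_one, mul_zero, Real.exp_zero, hφ0, hφ1, Real.norm_eq_abs] at hfin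
  -- Undoing the integrating factor at s = 1 cancels e^Λ and leaves exactly D.
  have hexp : P.real (⋃ α, E α)ᶜ - Real.exp (-Λ) =
      Real.exp (-Λ) * (Real.exp Λ * P.real (⋃ α, E α)ᶜ - 1) := by
    rw [mul_sub, ← mul_assoc, ← Real.exp_add]; simp
  rw [hexp, abs_mul, Real.abs_exp]
  calc _ ≤ Real.exp (-Λ) * (Real.exp Λ * D) := by gcongr
    _ = D := by rw [← mul_assoc, ← Real.exp_add]; simp

end PoissonApproximation

/-! ### Densities of finite product measures. -/

section ProductMeasures

theorem lintegral_pi_prod_eq_prod {α : Type*} [MeasurableSpace α] (μ : Measure α) [SigmaFinite μ]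
    {n : ℕ} {f : Fin n → α → ENNReal} (hf : ∀ i, Measurable (f i)) :
    ∫⁻ x, ∏ i, f i (x i) ∂(Measure.pi fun _ : Fin n => μ) = ∏ i, ∫⁻ x, f i x ∂μ := by
  induction n with
  | zero => simp
  | succ n ih =>
    have hmp := (measurePreserving_piFinSuccAbove (fun _ : Fin (n + 1) => μ) 0).symm
    rw [← hmp.lintegral_comp_emb (MeasurableEquiv.measurableEmbedding _)]
    have hsucc : ∀ z : α × (Fin n → α),
        ∏ i, f i ((MeasurableEquiv.piFinSuccAbove (fun _ : Fin (n + 1) => α) 0).symm z i) =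
          f 0 z.1 * ∏ i, f (Fin.succ i) (z.2 i) := fun z => by
      rw [Fin.prod_univ_succ]; rfl
    rw [lintegral_congr hsucc, Fin.prod_univ_succ, lintegral_prod_mul (g := fun x : Fin n → α => ∏ i, f (Fin.succ i) (x i)) (hf 0).aemeasurable
      (Finset.measurable_prod _ fun i _ => (hf _).comp (measurable_pi_apply i)).aemeasurable,
      ih fun i => hf _]

theorem pi_withDensity_eq {α : Type*} [MeasurableSpace α] (μ : Measure α) [SigmaFinite μ]
    {n : ℕ} {f : α → ENNReal} (hf : Measurable f) [SigmaFinite (μ.withDensity f)] :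
    (Measure.pi fun _ : Fin n => μ.withDensity f) =
      (Measure.pi fun _ : Fin n => μ).withDensity fun x => ∏ i, f (x i) := by
  refine Measure.pi_eq fun s hs => ?_
  rw [withDensity_apply _ (.univ_pi hs), ← lintegral_indicator (.univ_pi hs)]
  have : (Set.univ.pi s).indicator (fun x : Fin n → α => ∏ i, f (x i)) =
      fun x => ∏ i, (s i).indicator f (x i) := by
    ext x
    by_cases hx : x ∈ Set.univ.pi s
    · rw [Set.indicator_of_mem hx]
      exact Finset.prod_congr rfl fun i _ => by
        rw [Set.indicator_of_mem (hx i (Set.mem_univ i))]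
    · rw [Set.indicator_of_notMem hx]
      simp only [Set.mem_pi, Set.mem_univ, forall_const, not_forall] at hx
      obtain ⟨i, hi⟩ := hx
      exact (Finset.prod_eq_zero (Finset.mem_univ i) (Set.indicator_of_notMem hi _)).symm
  rw [this, lintegral_pi_prod_eq_prod μ fun i => hf.indicator (hs i)]
  exact Finset.prod_congr rfl fun i _ => by
    rw [lintegral_indicator (hs i), withDensity_apply _ (hs i)]

end ProductMeasures

/-! ### The joint density of the central angles. -/

section AngleLaw

/-- The law on `[0, 2π)` of the angle from `x` to a random angle with the periodic density `p`. -/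
noncomputable def angleLaw (p : ℝ → ℝ) (x : ℝ) : Measure ℝ :=
  (volume.restrict (Set.Ico 0 (2 * Real.pi))).withDensity fun y => ENNReal.ofReal (p (x + y))

theorem measurable_toIcoMod_two_pi : Measurable (toIcoMod Real.two_pi_pos 0) := by
  have : toIcoMod Real.two_pi_pos 0 = fun b => Int.fract (b / (2 * Real.pi)) * (2 * Real.pi) := by
    ext b; exact toIcoMod_eq_fract_mul _ b
  rw [this]
  fun_prop

theorem toIcoMod_toIocMod_two_pi (a b x : ℝ) (h : 0 < 2 * Real.pi) :
    toIcoMod Real.two_pi_pos b (toIocMod h a x) = toIcoMod Real.two_pi_pos b x := by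
  rw [toIocMod, toIcoMod_sub_zsmul]

theorem toIcoMod_arg_exp (x : ℝ) :
    toIcoMod Real.two_pi_pos 0 (Complex.arg (Circle.exp x : ℂ)) =
      toIcoMod Real.two_pi_pos 0 x := by
  rw [Circle.coe_exp, Complex.arg_exp_mul_I, toIcoMod_toIocMod_two_pi]

theorem centralAngle_exp {d : ℕ} (θ : Fin (d + 1) → ℝ) (i : Fin d) :
    centralAngle (fun j => Circle.exp (θ j)) i =
      toIcoMod Real.two_pi_pos 0 (θ i.succ - θ 0) := by
  rw [centralAngle, ← Circle.exp_sub, toIcoMod_arg_exp]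

theorem centralAngle_mem_Ico {d : ℕ} (u : Fin (d + 1) → Circle) (i : Fin d) :
    centralAngle u i ∈ Set.Ico 0 (2 * Real.pi) :=
  toIcoMod_mem_Ico' _ _

theorem continuous_circle_coe : Continuous fun z : Circle => (z : ℂ) := by fun_prop

theorem measurable_circle_angle : Measurable fun z : Circle =>
    toIcoMod Real.two_pi_pos 0 (Complex.arg (z : ℂ)) :=
  measurable_toIcoMod_two_pi.comp (Complex.measurable_arg.comp continuous_circle_coe.measurable)

theorem measurable_centralAngle {d : ℕ} :
    Measurable (centralAngle : (Fin (d + 1) → Circle) → Fin d → ℝ) := by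
  refine measurable_pi_lambda _ fun i => measurable_circle_angle.comp ?_
  exact ((continuous_apply i.succ).div' (continuous_apply 0)).measurable

variable {p : ℝ → ℝ}

theorem circleLaw_eq_map_angleLaw : circleLaw p = (angleLaw p 0).map Circle.exp := by
  simp [circleLaw, angleLaw]

theorem angleLaw_apply (p : ℝ → ℝ) (x : ℝ) {B : Set ℝ} (hB : MeasurableSet B) :
    angleLaw p x B = ∫⁻ y in Set.Ico 0 (2 * Real.pi),
      B.indicator (fun y => ENNReal.ofReal (p (x + y))) y := by
  rw [angleLaw, withDensity_apply _ hB, lintegral_indicator hB]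

/-- Any two intervals of length 2π are fundamental domains for the translations by 2πℤ. -/
theorem setLIntegral_Ico_two_pi_of_periodic {g : ℝ → ENNReal}
    (hg : Function.Periodic g (2 * Real.pi)) (x : ℝ) :
    ∫⁻ y in Set.Ico 0 (2 * Real.pi), g (x + y) = ∫⁻ y in Set.Ico 0 (2 * Real.pi), g y := by
  have h1 : ∀ t : ℝ, ∫⁻ y in Set.Ico t (t + 2 * Real.pi), g y =
      ∫⁻ y in Set.Ioc t (t + 2 * Real.pi), g y := fun t =>
    setLIntegral_congr Ico_ae_eq_Ioc
  have h2 : ∫⁻ y in Set.Ioc x (x + 2 * Real.pi), g y =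
      ∫⁻ y in Set.Ioc 0 (0 + 2 * Real.pi), g y :=
    (isAddFundamentalDomain_Ioc Real.two_pi_pos x).setLIntegral_eq
      (isAddFundamentalDomain_Ioc Real.two_pi_pos 0) g hg.map_vadd_zmultiples
  have h3 : ∫⁻ y in Set.Ico 0 (2 * Real.pi), g (x + y) =
      ∫⁻ y in Set.Ico x (x + 2 * Real.pi), g y := by
    rw [← lintegral_indicator measurableSet_Ico, ← lintegral_indicator measurableSet_Ico,
      ← lintegral_add_left_eq_self ((Set.Ico x (x + 2 * Real.pi)).indicator g) x]
    congr 1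
    ext y
    simp [Set.indicator]
  rw [h3, h1, h2, ← h1, zero_add]

/-- Substitute θ = x + y: by periodicity the integral may still run over y in [0, 2π), where
reducing x + y - x modulo 2π returns y. -/
theorem map_toIcoMod_sub_angleLaw
    (hper : Function.Periodic p (2 * Real.pi)) (x : ℝ) :
    (angleLaw p 0).map (fun θ => toIcoMod Real.two_pi_pos 0 (θ - x)) = angleLaw p x := by
  have hm : Measurable fun θ => toIcoMod Real.two_pi_pos 0 (θ - x) :=
    measurable_toIcoMod_two_pi.comp (measurable_id.sub_const x)
  ext B hB
  rw [Measure.map_apply hm hB, angleLaw_apply p 0 (hm hB), angleLaw_apply p x hB,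
    ← setLIntegral_Ico_two_pi_of_periodic _ x]
  · refine setLIntegral_congr_fun measurableSet_Ico fun y hy => ?_
    have : toIcoMod Real.two_pi_pos 0 (x + y - x) = y := by
      rw [add_sub_cancel_left]
      exact (toIcoMod_eq_self _).2 (by simpa using hy)
    have hiff : x + y ∈ (fun θ => toIcoMod Real.two_pi_pos 0 (θ - x)) ⁻¹' B ↔ y ∈ B := by
      simp only [Set.mem_preimage, this]
    simp only [zero_add]
    by_cases h : y ∈ B
    · rw [Set.indicator_of_mem (hiff.2 h), Set.indicator_of_mem h]
    · rw [Set.indicator_of_notMem (mt hiff.1 h), Set.indicator_of_notMem h]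
  · intro y
    have : toIcoMod Real.two_pi_pos 0 (y + 2 * Real.pi - x) =
        toIcoMod Real.two_pi_pos 0 (y - x) := by
      rw [add_sub_right_comm, toIcoMod_add_right]
    have hiff : y + 2 * Real.pi ∈ (fun θ => toIcoMod Real.two_pi_pos 0 (θ - x)) ⁻¹' B ↔
        y ∈ (fun θ => toIcoMod Real.two_pi_pos 0 (θ - x)) ⁻¹' B := by
      simp only [Set.mem_preimage, this]
    simp only [zero_add]
    by_cases h : y ∈ (fun θ => toIcoMod Real.two_pi_pos 0 (θ - x)) ⁻¹' B
    · rw [Set.indicator_of_mem (hiff.2 h), Set.indicator_of_mem h, hper y]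
    · rw [Set.indicator_of_notMem (mt hiff.1 h), Set.indicator_of_notMem h]

theorem measurable_ofReal_comp_add (hp : Continuous p) (x : ℝ) :
    Measurable fun y => ENNReal.ofReal (p (x + y)) := by fun_prop

theorem isProbabilityMeasure_angleLaw (hp : Continuous p) (hp0 : ∀ x, 0 ≤ p x)
    (hper : Function.Periodic p (2 * Real.pi))
    (hp1 : ∫ x in (0 : ℝ)..(2 * Real.pi), p x = 1) (x : ℝ) :
    IsProbabilityMeasure (angleLaw p x) := by
  refine ⟨?_⟩
  rw [angleLaw_apply p x MeasurableSet.univ, Set.indicator_univ,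
    setLIntegral_Ico_two_pi_of_periodic (g := fun y => ENNReal.ofReal (p y))
      (fun y => congrArg _ (hper y)),
    setLIntegral_congr (Ico_ae_eq_Ioc), ← ofReal_integral_eq_lintegral_ofReal,
    ← intervalIntegral.integral_of_le Real.two_pi_pos.le, hp1, ENNReal.ofReal_one]
  · exact (hp.integrableOn_Icc).mono_set Set.Ioc_subset_Icc_self
  · exact Eventually.of_forall hp0

/-- The angle from a fixed point of the circle to a random one has law `angleLaw`. -/
theorem circleLaw_angle_div (hper : Function.Periodic p (2 * Real.pi))
    (z : Circle) {B : Set ℝ} (hB : MeasurableSet B) :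
    circleLaw p {y | toIcoMod Real.two_pi_pos 0 (Complex.arg ((y / z : Circle) : ℂ)) ∈ B} =
      angleLaw p (Complex.arg z) B := by
  have hm : Measurable fun y : Circle =>
      toIcoMod Real.two_pi_pos 0 (Complex.arg ((y / z : Circle) : ℂ)) :=
    measurable_circle_angle.comp (continuous_id.div' continuous_const).measurable
  have hm' : Measurable fun θ => toIcoMod Real.two_pi_pos 0 (θ - Complex.arg z) :=
    measurable_toIcoMod_two_pi.comp (measurable_id.sub_const _)
  rw [← map_toIcoMod_sub_angleLaw hper, Measure.map_apply hm' hB, circleLaw_eq_map_angleLaw,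
    Measure.map_apply Circle.exp.continuous.measurable (show MeasurableSet {y : Circle |
      toIcoMod Real.two_pi_pos 0 (Complex.arg ((y / z : Circle) : ℂ)) ∈ B} from hm hB)]
  congr 1
  ext θ
  simp only [Set.mem_preimage, Set.mem_ofPred_eq]
  rw [← toIcoMod_arg_exp (θ - _), Circle.exp_sub, Circle.exp_arg]

/-- The cube `[0, 2π)^d`. -/
def angleIcoCube (d : ℕ) : Set (Fin d → ℝ) := Set.univ.pi fun _ => Set.Ico 0 (2 * Real.pi)

theorem shiftIntegral_eq_setIntegral {d : ℕ} (p : ℝ → ℝ) (y : Fin d → ℝ) :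
    shiftIntegral p y = ∫ x in Set.Ico 0 (2 * Real.pi), p x * ∏ l, p (x + y l) := by
  rw [shiftIntegral, intervalIntegral.integral_of_le Real.two_pi_pos.le,
    setIntegral_congr_set Ico_ae_eq_Ioc]

theorem shiftIntegral_nonneg {d : ℕ} (hp0 : ∀ x, 0 ≤ p x) (y : Fin d → ℝ) :
    0 ≤ shiftIntegral p y :=
  intervalIntegral.integral_nonneg Real.two_pi_pos.le fun x _ =>
    mul_nonneg (hp0 x) (Finset.prod_nonneg fun _ _ => hp0 _)

theorem ofReal_shiftIntegral {d : ℕ} (hp : Continuous p) (hp0 : ∀ x, 0 ≤ p x)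
    (y : Fin d → ℝ) :
    ENNReal.ofReal (shiftIntegral p y) = ∫⁻ x in Set.Ico 0 (2 * Real.pi),
      ENNReal.ofReal (p x) * ∏ l, ENNReal.ofReal (p (x + y l)) := by
  rw [shiftIntegral_eq_setIntegral, ofReal_integral_eq_lintegral_ofReal]
  · refine lintegral_congr fun x => ?_
    rw [ENNReal.ofReal_mul (hp0 x), ENNReal.ofReal_prod_of_nonneg fun _ _ => hp0 _]
  · have : Continuous fun x => p x * ∏ l, p (x + y l) := by fun_prop
    exact this.integrableOn_Icc.mono_set Set.Ico_subset_Icc_self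
  · exact Eventually.of_forall fun x =>
      mul_nonneg (hp0 x) (Finset.prod_nonneg fun _ _ => hp0 _)

theorem continuous_shiftIntegral {d : ℕ} (hp : Continuous p) :
    Continuous (shiftIntegral p : (Fin d → ℝ) → ℝ) := by
  unfold shiftIntegral
  refine intervalIntegral.continuous_parametric_intervalIntegral_of_continuous' ?_ _ _
  fun_prop

/-- The central angles of independent points with density `p` have density `shiftIntegral p`. -/
theorem pi_circleLaw_centralAngle_preimage {d : ℕ} (hp : Continuous p) (hp0 : ∀ x, 0 ≤ p x)
    (hper : Function.Periodic p (2 * Real.pi))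
    (hp1 : ∫ x in (0 : ℝ)..(2 * Real.pi), p x = 1) {S : Set (Fin d → ℝ)} (hS : MeasurableSet S) :
    (Measure.pi fun _ : Fin (d + 1) => circleLaw p) (centralAngle ⁻¹' S) =
      ∫⁻ y in S ∩ angleIcoCube d, ENNReal.ofReal (shiftIntegral p y) := by
  have hprob := isProbabilityMeasure_angleLaw hp hp0 hper hp1
  have hexp : Measurable (Circle.exp : ℝ → Circle) := Circle.exp.continuous.measurable
  have hprob' : IsProbabilityMeasure ((angleLaw p 0).map Circle.exp) :=
    Measure.isProbabilityMeasure_map hexp.aemeasurable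
  have hmapexp : Measurable fun (θ : Fin (d + 1) → ℝ) i => Circle.exp (θ i) :=
    measurable_pi_lambda _ fun i => hexp.comp (measurable_pi_apply i)
  have hT : MeasurableSet (centralAngle ⁻¹' S : Set (Fin (d + 1) → Circle)) :=
    measurable_centralAngle hS
  rw [circleLaw_eq_map_angleLaw, ← Measure.pi_map_pi fun _ => hexp.aemeasurable,
    Measure.map_apply hmapexp hT]
  have hmp := (measurePreserving_piFinSuccAbove (fun _ : Fin (d + 1) => angleLaw p 0) 0).symm
  rw [← hmp.measure_preimage (hmapexp hT).nullMeasurableSet,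
    Measure.prod_apply (hmp.measurable (hmapexp hT))]
  -- Condition on the angle x of the reference point: seen from x, the other angles are independent
  -- with law `angleLaw p x`.
  have hsec : ∀ x, (Measure.pi fun _ : Fin d => angleLaw p 0)
      (Prod.mk x ⁻¹' ((MeasurableEquiv.piFinSuccAbove (fun _ : Fin (d + 1) => ℝ) 0).symm ⁻¹'
        ((fun (θ : Fin (d + 1) → ℝ) i => Circle.exp (θ i)) ⁻¹' (centralAngle ⁻¹' S)))) =
      ∫⁻ y in S ∩ angleIcoCube d, ∏ l, ENNReal.ofReal (p (x + y l)) := by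
    intro x
    have hmx : Measurable fun θ => toIcoMod Real.two_pi_pos 0 (θ - x) :=
      measurable_toIcoMod_two_pi.comp (measurable_id.sub_const x)
    have h1 : Prod.mk x ⁻¹' ((MeasurableEquiv.piFinSuccAbove (fun _ : Fin (d + 1) => ℝ) 0).symm ⁻¹'
        ((fun (θ : Fin (d + 1) → ℝ) i => Circle.exp (θ i)) ⁻¹' (centralAngle ⁻¹' S))) =
        (fun (θ : Fin d → ℝ) i => toIcoMod Real.two_pi_pos 0 (θ i - x)) ⁻¹' S := by
      ext θ
      simp only [Set.mem_preimage, MeasurableEquiv.piFinSuccAbove_symm_apply,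
        Fin.insertNthEquiv, Equiv.coe_fn_mk, Fin.insertNth_zero']
      have : centralAngle (fun i => Circle.exp ((Fin.cons x θ : Fin (d + 1) → ℝ) i)) =
          fun i => toIcoMod Real.two_pi_pos 0 (θ i - x) := by
        ext i
        rw [centralAngle_exp]
        simp
      rw [this]
    have hprobx : IsProbabilityMeasure
        ((angleLaw p 0).map fun θ => toIcoMod Real.two_pi_pos 0 (θ - x)) :=
      Measure.isProbabilityMeasure_map hmx.aemeasurable
    have hsf : SigmaFinite ((volume.restrict (Set.Ico 0 (2 * Real.pi))).withDensity
        fun y => ENNReal.ofReal (p (x + y))) := by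
      have := hprob x
      rw [angleLaw] at this
      infer_instance
    have hpi : Measurable fun (θ : Fin d → ℝ) i => toIcoMod Real.two_pi_pos 0 (θ i - x) :=
      measurable_pi_lambda _ fun i => hmx.comp (measurable_pi_apply i)
    rw [h1, ← Measure.map_apply hpi hS, Measure.pi_map_pi fun _ => hmx.aemeasurable,
      map_toIcoMod_sub_angleLaw hper, angleLaw,
      pi_withDensity_eq _ (measurable_ofReal_comp_add hp x), withDensity_apply _ hS,
      ← Measure.restrict_pi_pi, Measure.restrict_restrict hS]
    rfl
  simp_rw [hsec]
  have hjoint : Measurable fun z : ℝ × (Fin d → ℝ) => ∏ l, ENNReal.ofReal (p (z.1 + z.2 l)) := by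
    fun_prop
  have hinner : Measurable fun x => ∫⁻ y in S ∩ angleIcoCube d, ∏ l, ENNReal.ofReal (p (x + y l)) :=
    hjoint.lintegral_prod_right'
  rw [angleLaw, lintegral_withDensity_eq_lintegral_mul _ (measurable_ofReal_comp_add hp 0) hinner]
  simp only [zero_add, Pi.mul_apply]
  have h2 : ∀ x, ENNReal.ofReal (p x) *
      ∫⁻ y in S ∩ angleIcoCube d, ∏ l, ENNReal.ofReal (p (x + y l)) =
      ∫⁻ y in S ∩ angleIcoCube d, ENNReal.ofReal (p x) * ∏ l, ENNReal.ofReal (p (x + y l)) :=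
    fun x => (lintegral_const_mul _ (hjoint.comp measurable_prodMk_left)).symm
  simp_rw [h2]
  -- By Tonelli, integrating out x first leaves the density `shiftIntegral p`.
  rw [lintegral_lintegral_swap]
  · exact lintegral_congr fun y => (ofReal_shiftIntegral hp hp0 y).symm
  · exact (Measurable.mul (by fun_prop) hjoint).aemeasurable

theorem isBounded_angleIcoCube (d : ℕ) : Bornology.IsBounded (angleIcoCube d) :=
  Bornology.IsBounded.pi fun _ => Metric.isBounded_Ico _ _

theorem integrableOn_shiftIntegral {d : ℕ} (hp : Continuous p) {B : Set (Fin d → ℝ)}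
    (hB : Bornology.IsBounded B) : IntegrableOn (shiftIntegral p) B :=
  ((continuous_shiftIntegral hp).continuousOn.integrableOn_compact
    hB.isCompact_closure).mono_set subset_closure

/-- The selection enters only through its injectivity, so all selections succeed with the same
probability. -/
theorem measureReal_centralAngle_mem {d : ℕ} (hp : Continuous p) (hp0 : ∀ x, 0 ≤ p x)
    (hper : Function.Periodic p (2 * Real.pi))
    (hp1 : ∫ x in (0 : ℝ)..(2 * Real.pi), p x = 1) {S : Set (Fin d → ℝ)} (hS : MeasurableSet S)
    {Ω : Type*} [MeasurableSpace Ω] {P : Measure Ω} [IsProbabilityMeasure P]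
    {ι : Type*} {U : ι → Ω → Circle} (hmeas : ∀ i, Measurable (U i)) (hindep : iIndepFun U P)
    (hlaw : ∀ i, P.map (U i) = circleLaw p) {e : Fin (d + 1) → ι} (he : Function.Injective e) :
    P.real {ω | centralAngle (fun j => U (e j) ω) ∈ S} =
      ∫ y in S ∩ angleIcoCube d, shiftIntegral p y := by
  have hmap := (iIndepFun_iff_map_fun_eq_pi_map fun j => (hmeas (e j)).aemeasurable).1
    (hindep.precomp he)
  simp only [hlaw] at hmap
  have hm : Measurable fun ω j => U (e j) ω := measurable_pi_lambda _ fun j => hmeas _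
  have h1 : P {ω | centralAngle (fun j => U (e j) ω) ∈ S} =
      ∫⁻ y in S ∩ angleIcoCube d, ENNReal.ofReal (shiftIntegral p y) := by
    rw [← pi_circleLaw_centralAngle_preimage hp hp0 hper hp1 hS, ← hmap,
      Measure.map_apply hm (measurable_centralAngle hS)]
    rfl
  rw [measureReal_def, h1, ← ofReal_integral_eq_lintegral_ofReal, ENNReal.toReal_ofReal]
  · exact integral_nonneg fun y => shiftIntegral_nonneg hp0 y
  · exact integrableOn_shiftIntegral hp ((isBounded_angleIcoCube d).subset Set.inter_subset_right)
  · exact Eventually.of_forall fun y => shiftIntegral_nonneg hp0 y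

theorem angleLaw_le {M : ℝ} (hp1 : ∀ x, p x ≤ M) (x : ℝ) {B : Set ℝ} (hB : MeasurableSet B) :
    angleLaw p x B ≤ ENNReal.ofReal M * volume B := by
  rw [angleLaw, withDensity_apply _ hB]
  calc _ ≤ ∫⁻ _ in B, ENNReal.ofReal M ∂(volume.restrict (Set.Ico 0 (2 * Real.pi))) :=
        lintegral_mono fun y => ENNReal.ofReal_le_ofReal (hp1 _)
    _ = ENNReal.ofReal M * (volume.restrict (Set.Ico 0 (2 * Real.pi))) B := by
        rw [lintegral_const, Measure.restrict_apply_univ]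
    _ ≤ _ := by gcongr; exact Measure.restrict_le_self

end AngleLaw

/-! ### Second order expansion at a critical point. -/

section SecondOrder

variable {E : Type*} [NormedAddCommGroup E] [NormedSpace ℝ E]

/-- Second order Taylor expansion at a critical point. -/
theorem isLittleO_sub_half_snd_fderiv {g : E → ℝ} {v : E} (hg : ContDiffAt ℝ 2 g v)
    (hcrit : fderiv ℝ g v = 0) :
    (fun w => g (v + w) - g v - fderiv ℝ (fderiv ℝ g) v w w / 2) =o[𝓝 0]
      fun w => ‖w‖ ^ 2 := by
  set L := fderiv ℝ (fderiv ℝ g) v with hL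
  have hsymm : IsSymmSndFDerivAt ℝ g v := hg.isSymmSndFDerivAt (by simp)
  have hdiff : DifferentiableAt ℝ (fderiv ℝ g) v :=
    (hg.fderiv_right (m := 1) (by norm_num)).differentiableAt (by norm_num)
  have hlittle : (fun w => fderiv ℝ g (v + w) - L w) =o[𝓝 0] fun w => w := by
    have := hasFDerivAt_iff_isLittleO_nhds_zero.1 hdiff.hasFDerivAt
    simpa [hcrit] using this
  have hev : ∀ᶠ w in 𝓝 (0 : E), DifferentiableAt ℝ g (v + w) := by
    have h1 : ∀ᶠ y in 𝓝 v, DifferentiableAt ℝ g y := by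
      filter_upwards [hg.eventually (by simp)] with y hy
      exact hy.differentiableAt (by norm_num)
    have : Tendsto (fun w => v + w) (𝓝 0) (𝓝 v) := by
      simpa using (continuous_const_add v).tendsto 0
    exact this.eventually h1
  rw [Asymptotics.isLittleO_iff]
  intro c hc
  obtain ⟨r, hr, hball⟩ := Metric.eventually_nhds_iff_ball.1 (hev.and (hlittle.bound hc))
  filter_upwards [Metric.ball_mem_nhds (0 : E) hr] with w hw
  have hderiv : ∀ y ∈ Metric.ball (0 : E) r,
      HasFDerivAt (fun w => g (v + w) - g v - L w w / 2) (fderiv ℝ g (v + y) - L y) y := by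
    intro y hy
    have h1 : HasFDerivAt (fun w => g (v + w)) (fderiv ℝ g (v + y)) y := by
      simpa [Function.comp_def] using
        (hball y hy).1.hasFDerivAt.comp y ((hasFDerivAt_id y).const_add v)
    have h2 : HasFDerivAt (fun w => L w w) (L y + L.flip y) y := by
      have := L.hasFDerivAt (x := y) |>.clm_apply (hasFDerivAt_id y)
      simpa using this
    -- Symmetry of the second derivative merges the two terms of the product rule.
    have h3 : HasFDerivAt (fun w => L w w / 2) (L y) y := by
      have := h2.const_mul (1 / 2 : ℝ)
      convert! this using 1
      · ext w; ring
      · ext w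
        have : L w y = L y w := hsymm w y
        simp [this]; ring
    exact (h1.sub_const (g v)).sub h3
  have hsub : Metric.ball (0 : E) r ∩ Metric.closedBall 0 ‖w‖ ⊆ Metric.ball 0 r :=
    Set.inter_subset_left
  -- The derivative of the remainder is o(y), hence at most c‖w‖ on the closed ball of radius ‖w‖;
  -- the mean value inequality from 0 to w then gives c‖w‖².
  have hmv := Convex.norm_image_sub_le_of_norm_hasFDerivWithin_le
    (f := fun w => g (v + w) - g v - L w w / 2) (f' := fun y => fderiv ℝ g (v + y) - L y)
    (s := Metric.ball (0 : E) r ∩ Metric.closedBall 0 ‖w‖) (C := c * ‖w‖) (x := 0) (y := w)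
    (fun y hy => (hderiv y hy.1).hasFDerivWithinAt)
    (fun y hy => ((hball y hy.1).2).trans (by
      have : ‖y‖ ≤ ‖w‖ := by simpa using hy.2
      gcongr))
    ((convex_ball _ _).inter (convex_closedBall _ _)) (by simp [hr]) ⟨hw, by simp⟩
  simp only [add_zero, sub_self, map_zero, zero_div, sub_zero] at hmv
  calc _ ≤ c * ‖w‖ * ‖w‖ := hmv
    _ = c * ‖‖w‖ ^ 2‖ := by rw [norm_pow, norm_norm]; ring

/-- The expansion along a ray, in the form needed for pointwise convergence of the rescaled sublevel
sets. -/
theorem tendsto_scaled_sub {g : E → ℝ} {v : E} (hg : ContDiffAt ℝ 2 g v)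
    (hcrit : fderiv ℝ g v = 0) (w : E) :
    Tendsto (fun s : ℝ => (g (v + s • w) - g v) / s ^ 2) (𝓝[>] 0)
      (𝓝 (fderiv ℝ (fderiv ℝ g) v w w / 2)) := by
  have h0 : Tendsto (fun s : ℝ => s • w) (𝓝[>] 0) (𝓝 0) := by
    have : Tendsto (fun s : ℝ => s • w) (𝓝 0) (𝓝 ((0 : ℝ) • w)) :=
      (continuous_id.smul continuous_const).tendsto 0
    rw [zero_smul] at this
    exact this.mono_left nhdsWithin_le_nhds
  have h1 := (isLittleO_sub_half_snd_fderiv hg hcrit).comp_tendsto h0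
  have h2 : (fun s : ℝ => g (v + s • w) - g v - fderiv ℝ (fderiv ℝ g) v (s • w) (s • w) / 2)
      =o[𝓝[>] 0] fun s : ℝ => s ^ 2 := by
    refine h1.trans_isBigO (Asymptotics.IsBigO.of_bound (‖w‖ ^ 2) (Eventually.of_forall fun s => ?_))
    simp only [Function.comp_apply, norm_smul, norm_pow, norm_mul, norm_norm]
    exact le_of_eq (by ring)
  have h3 := h2.tendsto_div_nhds_zero
  have h4 := h3.add_const (fderiv ℝ (fderiv ℝ g) v w w / 2)
  rw [zero_add] at h4
  refine h4.congr' ?_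
  filter_upwards [self_mem_nhdsWithin] with s hs
  have hs : s ≠ 0 := ne_of_gt hs
  simp only [map_smul, smul_apply, smul_eq_mul]
  field_simp
  ring

theorem snd_fderiv_nonneg_of_isLocalMin {g : E → ℝ} {v : E} (hg : ContDiffAt ℝ 2 g v)
    (hmin : IsLocalMin g v) (w : E) : 0 ≤ fderiv ℝ (fderiv ℝ g) v w w := by
  have h0 : Tendsto (fun s : ℝ => v + s • w) (𝓝[>] 0) (𝓝 v) := by
    have : Tendsto (fun s : ℝ => v + s • w) (𝓝 0) (𝓝 (v + (0 : ℝ) • w)) :=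
      (continuous_const.add (continuous_id.smul continuous_const)).tendsto 0
    rw [zero_smul, add_zero] at this
    exact this.mono_left nhdsWithin_le_nhds
  have := ge_of_tendsto (tendsto_scaled_sub hg hmin.fderiv_eq_zero w) (b := 0) (by
    filter_upwards [h0.eventually hmin] with s hs
    exact div_nonneg (sub_nonneg.2 hs) (sq_nonneg s))
  linarith

end SecondOrder

/-! ### Positive definite Hessians and quadratic growth. -/

section Hessian

variable {d : ℕ}

theorem dotProduct_hessianMatrix_mulVec {g : (Fin d → ℝ) → ℝ} {v : Fin d → ℝ}
    (hg : ContDiffAt ℝ 2 g v) (w : Fin d → ℝ) :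
    w ⬝ᵥ (hessianMatrix g v).mulVec w = fderiv ℝ (fderiv ℝ g) v w w := by
  have hdiff : DifferentiableAt ℝ (fderiv ℝ g) v :=
    (hg.fderiv_right (m := 1) (by norm_num)).differentiableAt (by norm_num)
  have hentry : ∀ a b, hessianMatrix g v a b =
      fderiv ℝ (fderiv ℝ g) v (Pi.single a 1) (Pi.single b 1) := by
    intro a b
    have := (hdiff.hasFDerivAt.clm_apply (hasFDerivAt_const (Pi.single b (1 : ℝ)) v)).fderiv
    simp [hessianMatrix, this]
  have hw : w = ∑ a, w a • (Pi.single a (1 : ℝ) : Fin d → ℝ) := by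
    ext i; simp [Finset.sum_apply, Pi.single_apply]
  conv_rhs => rw [hw]
  simp only [map_sum, map_smul, sum_apply, smul_apply,
    smul_eq_mul, dotProduct, Matrix.mulVec, hentry, Finset.mul_sum]
  rw [Finset.sum_comm]
  exact Finset.sum_congr rfl fun b _ => Finset.sum_congr rfl fun a _ => by ring

theorem hessianMatrix_isHermitian {g : (Fin d → ℝ) → ℝ} {v : Fin d → ℝ}
    (hg : ContDiffAt ℝ 2 g v) : (hessianMatrix g v).IsHermitian := by
  have hsymm : IsSymmSndFDerivAt ℝ g v := hg.isSymmSndFDerivAt (by simp)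
  have hdiff : DifferentiableAt ℝ (fderiv ℝ g) v :=
    (hg.fderiv_right (m := 1) (by norm_num)).differentiableAt (by norm_num)
  have hentry : ∀ a b, hessianMatrix g v a b =
      fderiv ℝ (fderiv ℝ g) v (Pi.single a 1) (Pi.single b 1) := by
    intro a b
    have := (hdiff.hasFDerivAt.clm_apply (hasFDerivAt_const (Pi.single b (1 : ℝ)) v)).fderiv
    simp [hessianMatrix, this]
  ext a b
  simp only [Matrix.conjTranspose_apply, hentry, star_trivial]
  exact hsymm _ _

theorem hessianMatrix_posDef {g : (Fin d → ℝ) → ℝ} {v : Fin d → ℝ}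
    (hg : ContDiffAt ℝ 2 g v) (hmin : IsLocalMin g v) (hdet : (hessianMatrix g v).det ≠ 0) :
    (hessianMatrix g v).PosDef := by
  refine Matrix.PosSemidef.posDef_iff_det_ne_zero ?_ |>.2 hdet
  refine Matrix.posSemidef_iff_dotProduct_mulVec.2 ⟨hessianMatrix_isHermitian hg, fun w => ?_⟩
  rw [star_trivial, dotProduct_hessianMatrix_mulVec hg]
  exact snd_fderiv_nonneg_of_isLocalMin hg hmin w

/-- The constant is the minimum of the quadratic form on the compact unit sphere; homogeneity does
the rest. -/
theorem Matrix.PosDef.exists_pos_mul_norm_sq_le {G : Matrix (Fin d) (Fin d) ℝ} (hG : G.PosDef) :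
    ∃ c > 0, ∀ w : Fin d → ℝ, c * ‖w‖ ^ 2 ≤ w ⬝ᵥ G.mulVec w := by
  have hcont : Continuous fun w : Fin d → ℝ => w ⬝ᵥ G.mulVec w := by fun_prop
  have hpos : ∀ w : Fin d → ℝ, w ≠ 0 → 0 < w ⬝ᵥ G.mulVec w := fun w hw => by
    simpa using (Matrix.posDef_iff_dotProduct_mulVec.1 hG).2 hw
  -- The sphere is empty exactly when d = 0.
  rcases (Metric.sphere (0 : Fin d → ℝ) 1).eq_empty_or_nonempty with he | hne
  · refine ⟨1, one_pos, fun w => ?_⟩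
    have : w = 0 := by
      by_contra hw
      have : ‖w‖⁻¹ • w ∈ Metric.sphere (0 : Fin d → ℝ) 1 := by
        simp [norm_smul, norm_ne_zero_iff.2 hw]
      simp [he] at this
    simp [this]
  · obtain ⟨u, hu, hmin⟩ := (isCompact_sphere (0 : Fin d → ℝ) 1).exists_isMinOn hne
      hcont.continuousOn
    have hu0 : u ≠ 0 := by
      rintro rfl; simp at hu
    refine ⟨_, hpos u hu0, fun w => ?_⟩
    by_cases hw : w = 0
    · simp [hw]
    have hwn : ‖w‖ ≠ 0 := norm_ne_zero_iff.2 hw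
    have h1 : u ⬝ᵥ G.mulVec u ≤ (‖w‖⁻¹ • w) ⬝ᵥ G.mulVec (‖w‖⁻¹ • w) :=
      hmin (by simp [norm_smul, hwn])
    rw [Matrix.mulVec_smul, dotProduct_smul, smul_dotProduct, smul_eq_mul, smul_eq_mul] at h1
    calc _ ≤ (‖w‖⁻¹ * (‖w‖⁻¹ * (w ⬝ᵥ G.mulVec w))) * ‖w‖ ^ 2 := by gcongr
      _ = _ := by field_simp

theorem exists_quadratic_lower_bound {g : (Fin d → ℝ) → ℝ} {v : Fin d → ℝ}
    (hg : ContDiffAt ℝ 2 g v) (hmin : IsLocalMin g v) (hdet : (hessianMatrix g v).det ≠ 0) :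
    ∃ c > 0, ∃ r > 0, ∀ y ∈ Metric.ball v r, c * ‖y - v‖ ^ 2 ≤ g y - g v := by
  obtain ⟨c, hc, hlow⟩ := (hessianMatrix_posDef hg hmin hdet).exists_pos_mul_norm_sq_le
  -- The quadratic term contributes c/2 and the remainder may take away half of it, which leaves
  -- c/4.
  have := (isLittleO_sub_half_snd_fderiv hg hmin.fderiv_eq_zero).bound (c := c / 4) (by positivity)
  obtain ⟨r, hr, hball⟩ := Metric.eventually_nhds_iff_ball.1 this
  refine ⟨c / 4, by positivity, r, hr, fun y hy => ?_⟩
  have h1 := hball (y - v) (by simpa [dist_eq_norm] using hy)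
  rw [← dotProduct_hessianMatrix_mulVec hg] at h1
  have h2 := hlow (y - v)
  simp only [add_sub_cancel, norm_pow, norm_norm] at h1
  have h3 := (abs_le.1 h1).1
  linarith

end Hessian

/-! ### Volume of an ellipsoid. -/

section Ellipsoid

variable {d : ℕ}

theorem Matrix.PosDef.exists_conjTranspose_mul_self {G : Matrix (Fin d) (Fin d) ℝ}
    (hG : G.PosDef) : ∃ B : Matrix (Fin d) (Fin d) ℝ, G = B.transpose * B := by
  open scoped MatrixOrder in
  obtain ⟨B, hB⟩ := CStarAlgebra.nonneg_iff_eq_star_mul_self.1 hG.posSemidef.nonneg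
  exact ⟨B, by simpa [Matrix.star_eq_conjTranspose] using hB⟩

theorem dotProduct_transpose_mul_self_mulVec (B : Matrix (Fin d) (Fin d) ℝ) (w : Fin d → ℝ) :
    w ⬝ᵥ (B.transpose * B).mulVec w = ‖WithLp.toLp 2 (Matrix.toLin' B w)‖ ^ 2 := by
  rw [EuclideanSpace.norm_sq_eq, ← Matrix.mulVec_mulVec, Matrix.dotProduct_mulVec,
    Matrix.vecMul_transpose]
  simp [dotProduct, sq]

/-- With G = BᵀB the ellipsoid is the preimage under B of the Euclidean ball of radius √2, so its
volume is that of the ball divided by |det B| = √det G. The boundary corresponds to a sphere; its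
nullity gives almost everywhere convergence of indicators later on. -/
theorem Matrix.PosDef.volume_ellipsoid (hd : 1 ≤ d) {G : Matrix (Fin d) (Fin d) ℝ}
    (hG : G.PosDef) :
    volume.real {w : Fin d → ℝ | w ⬝ᵥ G.mulVec w / 2 ≤ 1} =
      (2 * Real.pi) ^ ((d : ℝ) / 2) / Real.Gamma (((d : ℝ) + 2) / 2) * (1 / √G.det) ∧
    volume {w : Fin d → ℝ | w ⬝ᵥ G.mulVec w / 2 = 1} = 0 := by
  obtain ⟨B, rfl⟩ := hG.exists_conjTranspose_mul_self
  have hdetpos := hG.det_pos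
  rw [Matrix.det_mul, Matrix.det_transpose] at hdetpos
  have hB : B.det ≠ 0 := by rintro h; simp [h] at hdetpos
  have hB' : LinearMap.det (Matrix.toLin' B) ≠ 0 := by rwa [LinearMap.det_toLin']
  -- `Fin d → ℝ` carries the sup norm, so Euclidean balls are reached through `toLp 2`, which
  -- preserves volume.
  have hmp : MeasurePreserving (MeasurableEquiv.toLp 2 (Fin d → ℝ)) volume volume :=
    (EuclideanSpace.volume_preserving_symm_measurableEquiv_toLp (Fin d)).symm
  have hset1 : {w : Fin d → ℝ | w ⬝ᵥ (B.transpose * B).mulVec w / 2 ≤ 1} =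
      Matrix.toLin' B ⁻¹' ((MeasurableEquiv.toLp 2 (Fin d → ℝ)) ⁻¹'
        Metric.closedBall (0 : EuclideanSpace ℝ (Fin d)) √2) := by
    ext w
    simp only [Set.mem_ofPred_eq, Set.mem_preimage, dotProduct_transpose_mul_self_mulVec,
      MeasurableEquiv.toLp_apply, mem_closedBall_zero_iff]
    rw [Real.le_sqrt (norm_nonneg _) (by norm_num)]
    constructor <;> intro h <;> linarith
  have hset2 : {w : Fin d → ℝ | w ⬝ᵥ (B.transpose * B).mulVec w / 2 = 1} =
      Matrix.toLin' B ⁻¹' ((MeasurableEquiv.toLp 2 (Fin d → ℝ)) ⁻¹'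
        Metric.sphere (0 : EuclideanSpace ℝ (Fin d)) √2) := by
    ext w
    simp only [Set.mem_ofPred_eq, Set.mem_preimage, dotProduct_transpose_mul_self_mulVec,
      MeasurableEquiv.toLp_apply, mem_sphere_zero_iff_norm]
    rw [eq_comm (b := √2), Real.sqrt_eq_iff_eq_sq (by norm_num) (norm_nonneg _)]
    constructor <;> intro h <;> linarith
  have hne : Nonempty (Fin d) := ⟨⟨0, hd⟩⟩
  rw [hset1, hset2, measureReal_def, Measure.addHaar_preimage_linearMap _ hB',
    Measure.addHaar_preimage_linearMap _ hB',
    hmp.measure_preimage measurableSet_closedBall.nullMeasurableSet,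
    hmp.measure_preimage Metric.isClosed_sphere.measurableSet.nullMeasurableSet,
    EuclideanSpace.volume_closedBall, Measure.addHaar_sphere_of_ne_zero _ _ (by positivity)]
  refine ⟨?_, by simp⟩
  have hΓ : 0 < Real.Gamma ((d : ℝ) / 2 + 1) := Real.Gamma_pos_of_pos (by positivity)
  rw [ENNReal.toReal_mul, ENNReal.toReal_mul, ENNReal.toReal_ofReal (abs_nonneg _),
    ENNReal.toReal_pow, ENNReal.toReal_ofReal (by positivity), Fintype.card_fin,
    ENNReal.toReal_ofReal (by positivity), LinearMap.det_toLin', Matrix.det_mul,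
    Matrix.det_transpose, Real.sqrt_mul_self_eq_abs, abs_inv, mul_comm, one_div]
  congr 1
  have h1 : (2 * Real.pi) ^ ((d : ℝ) / 2) = √2 ^ d * √Real.pi ^ d := by
    rw [← mul_pow, ← Real.sqrt_mul (by norm_num), Real.sqrt_eq_rpow, ← Real.rpow_natCast,
      ← Real.rpow_mul (by positivity)]
    congr 1; ring
  rw [h1, mul_div_assoc]
  congr 3
  ring

end Ellipsoid

/-! ### Integrals over shrinking sublevel sets, by rescaling. -/

section Laplace

variable {d : ℕ}

/-- Asymptotics of integrals over small sublevel sets around a nondegenerate minimum. -/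
theorem tendsto_setIntegral_sublevel {F g q : (Fin d → ℝ) → ℝ} (hF : Continuous F)
    {v : Fin d → ℝ} {c r : ℝ} (hc : 0 < c) (hr : 0 < r)
    (hlow : ∀ y ∈ Metric.ball v r, c * ‖y - v‖ ^ 2 ≤ g y - g v)
    (hq : ∀ w, Tendsto (fun s : ℝ => (g (v + s • w) - g v) / s ^ 2) (𝓝[>] 0) (𝓝 (q w)))
    (hnull : volume {w | q w = 1} = 0) (hqm : MeasurableSet {w | q w ≤ 1})
    {A : ℝ → Set (Fin d → ℝ)} (hA : ∀ s, MeasurableSet (A s))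
    (hAmem : ∀ s y, y ∈ A s ↔ y ∈ Metric.ball v r ∧ g y - g v ≤ s ^ 2) :
    Tendsto (fun s : ℝ => (s ^ d)⁻¹ * ∫ y in A s, F y) (𝓝[>] 0)
      (𝓝 (F v * volume.real {w | q w ≤ 1})) := by
  obtain ⟨M, hM⟩ := (isCompact_closedBall v r).exists_bound_of_continuousOn hF.continuousOn
  -- Substitution y = v + s w, with Jacobian s^d.
  have hchange : ∀ s : ℝ, 0 < s → ∫ w, (A s).indicator F (v + s • w) =
      (s ^ d)⁻¹ * ∫ y in A s, F y := by
    intro s hs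
    have h1 := Measure.integral_comp_smul (volume : Measure (Fin d → ℝ))
      (fun x => (A s).indicator F (v + x)) s
    rw [h1, integral_add_left_eq_self (fun x => (A s).indicator F x) v,
      integral_indicator (hA s), Module.finrank_fin_fun, abs_of_pos (by positivity), smul_eq_mul]
  have hlim : ∫ w, {w | q w ≤ 1}.indicator (fun _ => F v) w =
      F v * volume.real {w | q w ≤ 1} := by
    rw [integral_indicator hqm, setIntegral_const, smul_eq_mul, mul_comm]
  rw [← hlim]
  have hpath : ∀ w : Fin d → ℝ, Tendsto (fun s : ℝ => v + s • w) (𝓝[>] 0) (𝓝 v) := by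
    intro w
    have : Tendsto (fun s : ℝ => v + s • w) (𝓝 0) (𝓝 (v + (0 : ℝ) • w)) :=
      (continuous_const.add (continuous_id.smul continuous_const)).tendsto 0
    rw [zero_smul, add_zero] at this
    exact this.mono_left nhdsWithin_le_nhds
  have key : Tendsto (fun s : ℝ => ∫ w, (A s).indicator F (v + s • w)) (𝓝[>] 0)
      (𝓝 (∫ w, {w | q w ≤ 1}.indicator (fun _ => F v) w)) := by
    -- Quadratic growth gives c‖w‖² ≤ 1 on the rescaled sets, so all of them lie in the ball of
    -- radius 1/√c.
    refine tendsto_integral_filter_of_dominated_convergence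
      ((Metric.closedBall (0 : Fin d → ℝ) (√c)⁻¹).indicator fun _ => M) ?_ ?_ ?_ ?_
    · refine Eventually.of_forall fun s => ?_
      exact ((hF.measurable.indicator (hA s)).comp (by fun_prop)).aestronglyMeasurable
    · filter_upwards [self_mem_nhdsWithin] with s hs
      have hs : 0 < s := hs
      refine Eventually.of_forall fun w => ?_
      by_cases hw : v + s • w ∈ A s
      · obtain ⟨h1, h2⟩ := (hAmem _ _).1 hw
        have h3 := (hlow _ h1).trans h2
        rw [add_sub_cancel_left, norm_smul, Real.norm_of_nonneg hs.le] at h3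
        have h4 : c * ‖w‖ ^ 2 ≤ 1 := by
          have : (c * ‖w‖ ^ 2) * s ^ 2 ≤ 1 * s ^ 2 := by linarith
          exact le_of_mul_le_mul_right this (by positivity)
        have h5 : w ∈ Metric.closedBall (0 : Fin d → ℝ) (√c)⁻¹ := by
          rw [mem_closedBall_zero_iff, ← Real.sqrt_inv]
          refine Real.le_sqrt_of_sq_le ?_
          rw [← one_div, le_div_iff₀ hc]
          linarith
        rw [Set.indicator_of_mem hw, Set.indicator_of_mem h5]
        exact hM _ (Metric.ball_subset_closedBall h1)
      · rw [Set.indicator_of_notMem hw, norm_zero]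
        refine Set.indicator_nonneg (fun _ _ => ?_) w
        exact (norm_nonneg _).trans (hM v (Metric.mem_closedBall_self hr.le))
    · rw [integrable_indicator_iff Metric.isClosed_closedBall.measurableSet]
      exact integrableOn_const (isCompact_closedBall _ _).measure_ne_top
    · have hne : ∀ᵐ w : Fin d → ℝ, q w ≠ 1 := by
        rw [ae_iff]; simpa using hnull
      filter_upwards [hne] with w hw
      have hball : ∀ᶠ s : ℝ in 𝓝[>] 0, v + s • w ∈ Metric.ball v r :=
        (hpath w).eventually (Metric.ball_mem_nhds v hr)
      -- Off the null set q = 1, the point v + s w is eventually inside or eventually outside `A s`,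
      -- according to the sign of q w - 1.
      rcases lt_or_gt_of_ne hw with h | h
      · rw [Set.indicator_of_mem (show w ∈ {w | q w ≤ 1} from h.le)]
        refine ((hF.tendsto v).comp (hpath w)).congr' ?_
        filter_upwards [hball, (hq w).eventually_lt_const h, self_mem_nhdsWithin] with s h1 h2 hs
        have hs : 0 < s := hs
        rw [Set.indicator_of_mem, Function.comp_apply]
        refine (hAmem _ _).2 ⟨h1, ?_⟩
        rw [div_lt_one (by positivity)] at h2
        exact h2.le
      · rw [Set.indicator_of_notMem (show w ∉ {w | q w ≤ 1} from not_le.2 h)]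
        refine tendsto_const_nhds.congr' ?_
        filter_upwards [(hq w).eventually_const_lt h, self_mem_nhdsWithin] with s h2 hs
        have hs : 0 < s := hs
        rw [Set.indicator_of_notMem]
        intro hmem
        rw [one_lt_div (by positivity)] at h2
        exact absurd ((hAmem _ _).1 hmem).2 (not_le.2 h2)
  refine key.congr' ?_
  filter_upwards [self_mem_nhdsWithin] with s hs
  exact hchange s hs

end Laplace

/-! ### Sublevel sets of h in the angle cube. -/

section Sublevel

variable {d : ℕ} {h : (Fin d → ℝ) → EReal} {μ : ℝ} {V : Finset (Fin d → ℝ)}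

theorem angleCube_eq_pi (d : ℕ) :
    angleCube d = Set.univ.pi fun _ => Set.Icc 0 (2 * Real.pi) := by
  ext x; simp only [angleCube, Set.mem_ofPred_eq, Set.mem_pi, Set.mem_univ, forall_const]

theorem isCompact_angleCube (d : ℕ) : IsCompact (angleCube d) := by
  rw [angleCube_eq_pi]
  exact isCompact_univ_pi fun _ => isCompact_Icc

theorem angleIcoCube_subset (d : ℕ) : angleIcoCube d ⊆ angleCube d := by
  rw [angleCube_eq_pi]
  exact Set.pi_mono fun _ _ => Set.Ico_subset_Icc_self

theorem angleIcoCube_mem_nhds {v : Fin d → ℝ} (hv : ∀ l, v l ∈ Set.Ioo 0 (2 * Real.pi)) :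
    angleIcoCube d ∈ 𝓝 v :=
  set_pi_mem_nhds Set.finite_univ fun l _ => Ico_mem_nhds (hv l).1 (hv l).2

/-- The part of the angle cube where `h` exceeds `μ` by at most `s²`. -/
def angleSublevel (h : (Fin d → ℝ) → EReal) (μ s : ℝ) : Set (Fin d → ℝ) :=
  {y | y ∈ angleCube d ∧ h y ≤ ((μ + s ^ 2 : ℝ) : EReal)}

theorem isClosed_angleSublevel (hcont : ContinuousOn h (angleCube d)) (s : ℝ) :
    IsClosed (angleSublevel h μ s) :=
  hcont.preimage_isClosed_of_isClosed (isCompact_angleCube d).isClosed isClosed_Iic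

/-- Passage from `EReal` to real analysis: h is finite near v, and since v is interior, the minimum
over the cube is a local minimum in the whole space. -/
theorem exists_local_data (hmin : IsLeast (h '' angleCube d) (μ : EReal))
    (hV : ∀ x ∈ angleCube d, h x = (μ : EReal) ↔ x ∈ V)
    (hVint : ∀ v ∈ V, ∀ l, v l ∈ Set.Ioo 0 (2 * Real.pi))
    (hsmooth : ∃ δ > 0, ∀ v ∈ V, (∀ x ∈ Metric.ball v δ, h x ≠ ⊤ ∧ h x ≠ ⊥) ∧
      ContDiffOn ℝ 3 (fun x => (h x).toReal) (Metric.ball v δ))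
    {v : Fin d → ℝ} (hv : v ∈ V) :
    ContDiffAt ℝ 2 (fun x => (h x).toReal) v ∧ IsLocalMin (fun x => (h x).toReal) v ∧
      (h v).toReal = μ ∧ ∀ᶠ y in 𝓝 v, h y = ((h y).toReal : EReal) := by
  obtain ⟨δ, hδ, hs⟩ := hsmooth
  obtain ⟨hfin, hdiff⟩ := hs v hv
  have hnhds := angleIcoCube_mem_nhds (hVint v hv)
  have hvμ : h v = (μ : EReal) := (hV v (angleIcoCube_subset d (mem_of_mem_nhds hnhds))).2 hv
  have hreal : ∀ᶠ y in 𝓝 v, h y = ((h y).toReal : EReal) := by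
    filter_upwards [Metric.ball_mem_nhds v hδ] with y hy
    exact (EReal.coe_toReal (hfin y hy).1 (hfin y hy).2).symm
  have hμ : (h v).toReal = μ := by rw [hvμ, EReal.toReal_coe]
  refine ⟨((hdiff v (Metric.mem_ball_self hδ)).contDiffAt (Metric.ball_mem_nhds v hδ)).of_le
    (by norm_num), ?_, hμ, hreal⟩
  filter_upwards [hreal, hnhds] with y hy hyc
  rw [hμ, ← EReal.coe_le_coe_iff, ← hy]
  exact hmin.2 ⟨y, angleIcoCube_subset d hyc, rfl⟩

/-- Finiteness of `V` makes the growth constant and the radius uniform; disjoint balls allow the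
integral to be split over the minima. -/
theorem exists_uniform_local_data (hmin : IsLeast (h '' angleCube d) (μ : EReal))
    (hV : ∀ x ∈ angleCube d, h x = (μ : EReal) ↔ x ∈ V)
    (hVint : ∀ v ∈ V, ∀ l, v l ∈ Set.Ioo 0 (2 * Real.pi))
    (hsmooth : ∃ δ > 0, ∀ v ∈ V, (∀ x ∈ Metric.ball v δ, h x ≠ ⊤ ∧ h x ≠ ⊥) ∧
      ContDiffOn ℝ 3 (fun x => (h x).toReal) (Metric.ball v δ))
    (hdet : ∀ v ∈ V, (hessianMatrix (fun x => (h x).toReal) v).det ≠ 0) :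
    ∃ c > 0, ∃ r > 0, (∀ v ∈ V, ∀ y ∈ Metric.ball v r, y ∈ angleIcoCube d ∧
      h y = ((h y).toReal : EReal) ∧ c * ‖y - v‖ ^ 2 ≤ (h y).toReal - μ) ∧
      (V : Set (Fin d → ℝ)).PairwiseDisjoint fun v => Metric.ball v r := by
  have hloc : ∀ v ∈ V, ∃ c > 0, ∀ᶠ r in 𝓝[>] (0 : ℝ), ∀ y ∈ Metric.ball v r,
      y ∈ angleIcoCube d ∧ h y = ((h y).toReal : EReal) ∧
        c * ‖y - v‖ ^ 2 ≤ (h y).toReal - μ := by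
    intro v hv
    obtain ⟨hg, hlm, hμ, hreal⟩ := exists_local_data hmin hV hVint hsmooth hv
    obtain ⟨c, hc, r, hr, hlow⟩ := exists_quadratic_lower_bound hg hlm (hdet v hv)
    obtain ⟨r', hr', hball⟩ := Metric.eventually_nhds_iff_ball.1
      (hreal.and (angleIcoCube_mem_nhds (hVint v hv)))
    refine ⟨c, hc, ?_⟩
    filter_upwards [Ioo_mem_nhdsGT (lt_min hr hr')] with ρ hρ y hy
    have h1 : y ∈ Metric.ball v r := Metric.ball_subset_ball (hρ.2.le.trans (min_le_left _ _)) hy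
    have h2 : y ∈ Metric.ball v r' := Metric.ball_subset_ball (hρ.2.le.trans (min_le_right _ _)) hy
    refine ⟨(hball y h2).2, (hball y h2).1, ?_⟩
    have := hlow y h1
    rwa [hμ] at this
  choose! c hc hloc using hloc
  have hc' : ∃ c₀ > 0, ∀ v ∈ V, c₀ ≤ c v := by
    rcases V.eq_empty_or_nonempty with rfl | hne
    · exact ⟨1, one_pos, by simp⟩
    · obtain ⟨v₀, hv₀, hle⟩ := V.exists_min_image c hne
      exact ⟨c v₀, hc v₀ hv₀, hle⟩
  obtain ⟨c₀, hc₀, hle⟩ := hc'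
  have hdisj : ∀ᶠ r in 𝓝[>] (0 : ℝ),
      ∀ x ∈ V, ∀ y ∈ V, x ≠ y → Disjoint (Metric.ball x r) (Metric.ball y r) := by
    rw [Filter.eventually_all_finset]
    intro x _
    rw [Filter.eventually_all_finset]
    intro y _
    by_cases hxy : x = y
    · simp [hxy]
    filter_upwards [Ioo_mem_nhdsGT (half_pos (dist_pos.2 hxy))] with r hr _
    exact Metric.ball_disjoint_ball (by linarith [hr.2])
  obtain ⟨r, h1, h2, hr⟩ := (((Filter.eventually_all_finset V).2 hloc).and
    (hdisj.and self_mem_nhdsWithin)).exists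
  refine ⟨c₀, hc₀, r, hr, fun v hv y hy => ?_, fun x hx y hy hxy => h2 x hx y hy hxy⟩
  obtain ⟨h3, h4, h5⟩ := h1 v hv y hy
  refine ⟨h3, h4, le_trans ?_ h5⟩
  gcongr
  exact hle v hv

/-- Small sublevel sets are contained in any neighbourhood of the set of minimum points. -/
theorem eventually_angleSublevel_subset (hcont : ContinuousOn h (angleCube d))
    (hmin : IsLeast (h '' angleCube d) (μ : EReal))
    (hV : ∀ x ∈ angleCube d, h x = (μ : EReal) ↔ x ∈ V) {r : ℝ} (hr : 0 < r) :
    ∀ᶠ s in 𝓝[>] (0 : ℝ), ∀ y ∈ angleSublevel h μ s, ∃ v ∈ V, y ∈ Metric.ball v r := by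
  -- On the compact remainder of the cube h attains a minimum, which exceeds μ; no lower level meets
  -- this remainder.
  set K := angleCube d \ ⋃ v ∈ V, Metric.ball v r with hK
  have hKc : IsCompact K := (isCompact_angleCube d).diff
    (isOpen_biUnion fun v _ => Metric.isOpen_ball)
  rcases K.eq_empty_or_nonempty with he | hne
  · refine Eventually.of_forall fun s y hy => ?_
    have : y ∉ K := by simp [he]
    by_contra hcon
    push Not at hcon
    exact this ⟨hy.1, by simpa using hcon⟩
  · obtain ⟨y₀, hy₀, hle⟩ := hKc.exists_isMinOn hne (hcont.mono Set.sdiff_subset)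
    have hlt : (μ : EReal) < h y₀ := by
      refine lt_of_le_of_ne (hmin.2 ⟨y₀, hy₀.1, rfl⟩) fun heq => hy₀.2 ?_
      exact Set.mem_biUnion ((hV y₀ hy₀.1).1 heq.symm) (Metric.mem_ball_self hr)
    -- A real level in between is needed because `h y₀` may be ⊤.
    obtain ⟨x, hx1, hx2⟩ := EReal.lt_iff_exists_real_btwn.1 hlt
    rw [EReal.coe_lt_coe_iff] at hx1
    have hsq : Tendsto (fun s : ℝ => μ + s ^ 2) (𝓝[>] 0) (𝓝 μ) := by
      have : Tendsto (fun s : ℝ => μ + s ^ 2) (𝓝 0) (𝓝 (μ + 0 ^ 2)) :=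
        Continuous.tendsto (by fun_prop) 0
      simp only [ne_eq, OfNat.ofNat_ne_zero, not_false_eq_true, zero_pow, add_zero] at this
      exact this.mono_left nhdsWithin_le_nhds
    filter_upwards [hsq.eventually_lt_const hx1] with s hs y hy
    by_contra hcon
    push Not at hcon
    have hyK : y ∈ K := ⟨hy.1, by simpa using hcon⟩
    have h1 : h y₀ ≤ ((μ + s ^ 2 : ℝ) : EReal) := (hle hyK).trans hy.2
    have h2 : ((μ + s ^ 2 : ℝ) : EReal) < x := EReal.coe_lt_coe_iff.2 hs
    exact absurd (h1.trans_lt (h2.trans hx2)) (lt_irrefl _)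

/-- Small sublevel sets are contained in small balls around the minimum points. -/
theorem exists_eventually_angleSublevel_subset_closedBall
    (hcont : ContinuousOn h (angleCube d))
    (hmin : IsLeast (h '' angleCube d) (μ : EReal))
    (hV : ∀ x ∈ angleCube d, h x = (μ : EReal) ↔ x ∈ V)
    (hVint : ∀ v ∈ V, ∀ l, v l ∈ Set.Ioo 0 (2 * Real.pi))
    (hsmooth : ∃ δ > 0, ∀ v ∈ V, (∀ x ∈ Metric.ball v δ, h x ≠ ⊤ ∧ h x ≠ ⊥) ∧
      ContDiffOn ℝ 3 (fun x => (h x).toReal) (Metric.ball v δ))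
    (hdet : ∀ v ∈ V, (hessianMatrix (fun x => (h x).toReal) v).det ≠ 0) :
    ∃ C > 0, ∀ᶠ s in 𝓝[>] (0 : ℝ), ∀ y ∈ angleSublevel h μ s, ∃ v ∈ V, ‖y - v‖ ≤ C * s := by
  obtain ⟨c, hc, r, hr, hdata, -⟩ := exists_uniform_local_data hmin hV hVint hsmooth hdet
  -- From c‖y - v‖² ≤ h y - μ ≤ s².
  refine ⟨(√c)⁻¹, by positivity, ?_⟩
  filter_upwards [eventually_angleSublevel_subset hcont hmin hV hr, self_mem_nhdsWithin]
    with s hs hs0 y hy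
  have hs0 : 0 < s := hs0
  obtain ⟨v, hv, hyv⟩ := hs y hy
  obtain ⟨-, hreal, hlow⟩ := hdata v hv y hyv
  refine ⟨v, hv, ?_⟩
  have h1 := hy.2
  rw [hreal, EReal.coe_le_coe_iff] at h1
  rw [inv_mul_eq_div, le_div_iff₀ (Real.sqrt_pos.2 hc)]
  refine le_of_sq_le_sq ?_ hs0.le
  rw [mul_pow, Real.sq_sqrt hc.le]
  linarith

/-- For small s the sublevel set is a disjoint union of one piece per minimum, each inside the
half-open cube; each piece contributes its rescaled ellipsoid volume times the density at the
minimum. -/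
theorem tendsto_setIntegral_angleSublevel (hd : 1 ≤ d) (hcont : ContinuousOn h (angleCube d))
    (hmin : IsLeast (h '' angleCube d) (μ : EReal))
    (hV : ∀ x ∈ angleCube d, h x = (μ : EReal) ↔ x ∈ V)
    (hVint : ∀ v ∈ V, ∀ l, v l ∈ Set.Ioo 0 (2 * Real.pi))
    (hsmooth : ∃ δ > 0, ∀ v ∈ V, (∀ x ∈ Metric.ball v δ, h x ≠ ⊤ ∧ h x ≠ ⊥) ∧
      ContDiffOn ℝ 3 (fun x => (h x).toReal) (Metric.ball v δ))
    (hdet : ∀ v ∈ V, (hessianMatrix (fun x => (h x).toReal) v).det ≠ 0)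
    {p : ℝ → ℝ} (hp : Continuous p) :
    Tendsto (fun s : ℝ => (s ^ d)⁻¹ * ∫ y in angleSublevel h μ s ∩ angleIcoCube d,
      shiftIntegral p y) (𝓝[>] 0) (𝓝 (limitConstant (fun x => (h x).toReal) V p)) := by
  obtain ⟨c, hc, r, hr, hdata, hdisj⟩ := exists_uniform_local_data hmin hV hVint hsmooth hdet
  have hmeas : ∀ v s, MeasurableSet (angleSublevel h μ s ∩ Metric.ball v r) := fun v s =>
    (isClosed_angleSublevel hcont s).measurableSet.inter measurableSet_ball
  have hterm : ∀ v ∈ V, Tendsto (fun s : ℝ => (s ^ d)⁻¹ *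
      ∫ y in angleSublevel h μ s ∩ Metric.ball v r, shiftIntegral p y) (𝓝[>] 0)
      (𝓝 ((2 * Real.pi) ^ ((d : ℝ) / 2) / Real.Gamma (((d : ℝ) + 2) / 2) *
        (1 / √(hessianMatrix (fun x => (h x).toReal) v).det * shiftIntegral p v))) := by
    intro v hv
    obtain ⟨hg, hlm, hμ, -⟩ := exists_local_data hmin hV hVint hsmooth hv
    obtain ⟨hvol, hnull⟩ := (hessianMatrix_posDef hg hlm (hdet v hv)).volume_ellipsoid hd
    have := tendsto_setIntegral_sublevel (continuous_shiftIntegral (d := d) hp) hc hr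
      (g := fun x => (h x).toReal) (v := v)
      (q := fun w => w ⬝ᵥ (hessianMatrix (fun x => (h x).toReal) v).mulVec w / 2)
      (fun y hy => by simpa only [hμ] using (hdata v hv y hy).2.2)
      (fun w => by
        simp only [dotProduct_hessianMatrix_mulVec hg]
        exact tendsto_scaled_sub hg hlm.fderiv_eq_zero w)
      hnull (measurableSet_le (Continuous.measurable (by fun_prop)) measurable_const)
      (A := fun s => angleSublevel h μ s ∩ Metric.ball v r) (hmeas v) (fun s y => by
        rw [Set.mem_inter_iff, and_comm]
        refine and_congr_right fun hy => ?_
        obtain ⟨h1, h2, -⟩ := hdata v hv y hy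
        rw [hμ, sub_le_iff_le_add', ← EReal.coe_le_coe_iff, ← h2]
        exact ⟨fun h3 => h3.2, fun h3 => ⟨angleIcoCube_subset d h1, h3⟩⟩)
    rw [hvol] at this
    convert! this using 2
    ring
  have hsum := tendsto_finsetSum V hterm
  rw [← Finset.mul_sum] at hsum
  refine hsum.congr' ?_
  filter_upwards [eventually_angleSublevel_subset hcont hmin hV hr] with s hs
  have hunion : angleSublevel h μ s ∩ angleIcoCube d =
      ⋃ v ∈ V, angleSublevel h μ s ∩ Metric.ball v r := by
    ext y
    simp only [Set.mem_inter_iff, Set.mem_iUnion, exists_prop]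
    constructor
    · rintro ⟨h1, -⟩
      obtain ⟨v, hv, hy⟩ := hs y h1
      exact ⟨v, hv, h1, hy⟩
    · rintro ⟨v, hv, h1, h2⟩
      exact ⟨h1, (hdata v hv y h2).1⟩
  rw [hunion, integral_biUnion_finset V (fun v _ => hmeas v s)
    (fun x hx y hy hxy => (hdisj hx hy hxy).mono Set.inter_subset_right Set.inter_subset_right)
    (fun v _ => integrableOn_shiftIntegral hp
      (Metric.isBounded_ball.subset Set.inter_subset_right)), Finset.mul_sum]

end Sublevel

/-! ### Pairwise angles in a near-minimal configuration. -/

section CloseAngles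

/-- The counterclockwise angle from `z` to `y`, in `[0, 2π)`. -/
noncomputable def circleAngle (z y : Circle) : ℝ :=
  toIcoMod Real.two_pi_pos 0 (Complex.arg ((y / z : Circle) : ℂ))

theorem measurable_circleAngle : Measurable fun z : Circle × Circle => circleAngle z.1 z.2 :=
  measurable_circle_angle.comp (continuous_snd.div' continuous_fst).measurable

/-- The angles which differ by at most `ρ` from a coordinate of a point of `V`. -/
def closeAngles {d : ℕ} (V : Finset (Fin d → ℝ)) (ρ : ℝ) : Set ℝ :=
  ⋃ v ∈ V, ⋃ l, Metric.closedBall (v l) ρ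

theorem measurableSet_closeAngles {d : ℕ} (V : Finset (Fin d → ℝ)) (ρ : ℝ) :
    MeasurableSet (closeAngles V ρ) :=
  V.measurableSet_biUnion fun _ _ => .iUnion fun _ => measurableSet_closedBall

theorem volume_closeAngles_le {d : ℕ} (V : Finset (Fin d → ℝ)) (ρ : ℝ) :
    volume (closeAngles V ρ) ≤ ENNReal.ofReal (V.card * (d * (2 * ρ))) := by
  calc _ ≤ ∑ v ∈ V, volume (⋃ l, Metric.closedBall (v l) ρ) := measure_biUnion_finset_le _ _
    _ ≤ ∑ v ∈ V, ∑ l, volume (Metric.closedBall (v l) ρ) :=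
      Finset.sum_le_sum fun v _ => measure_iUnion_fintype_le _ _
    _ = _ := by
      simp only [Real.volume_closedBall, Finset.sum_const, nsmul_eq_mul, Finset.card_univ,
        Fintype.card_fin]
      rw [ENNReal.ofReal_mul (p := (V.card : ℝ)) (by positivity),
        ENNReal.ofReal_mul (p := (d : ℝ)) (by positivity), ENNReal.ofReal_natCast, ENNReal.ofReal_natCast]

theorem Function.Periodic.exists_pos_bound {p : ℝ → ℝ} (hp : Continuous p)
    (hper : Function.Periodic p (2 * Real.pi)) : ∃ M > 0, ∀ x, p x ≤ M := by
  obtain ⟨M, hM⟩ := (isCompact_Icc (a := (0 : ℝ)) (b := 2 * Real.pi)).exists_bound_of_continuousOn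
    hp.continuousOn
  refine ⟨max M 1, by positivity, fun x => ?_⟩
  obtain ⟨y, hy, hxy⟩ := hper.exists_mem_Ico₀ Real.two_pi_pos x
  rw [hxy]
  exact (le_abs_self _).trans ((hM y (Set.Ico_subset_Icc_self hy)).trans (le_max_left _ _))

/-- Uniformity in z matters: the bound then holds conditionally on the position of the other point,
which is what overlapping selections require. -/
theorem exists_circleLaw_closeAngles_le {d : ℕ} (V : Finset (Fin d → ℝ)) {p : ℝ → ℝ}
    (hp : Continuous p) (hper : Function.Periodic p (2 * Real.pi)) :
    ∃ K ≥ 0, ∀ ρ z, circleLaw p {y | circleAngle z y ∈ closeAngles V ρ} ≤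
      ENNReal.ofReal (K * ρ) := by
  obtain ⟨M, hM, hpM⟩ := hper.exists_pos_bound hp
  refine ⟨M * (V.card * (d * 2)), by positivity, fun ρ z => ?_⟩
  refine (circleLaw_angle_div hper z (measurableSet_closeAngles V ρ)).le.trans ?_
  refine (angleLaw_le hpM _ (measurableSet_closeAngles V ρ)).trans ?_
  calc _ ≤ ENNReal.ofReal M * ENNReal.ofReal (V.card * (d * (2 * ρ))) := by
        gcongr; exact volume_closeAngles_le V ρ
    _ = _ := by rw [← ENNReal.ofReal_mul hM.le]; congr 1; ring

/-- Swapping 0 and i makes `u i` the reference point, so the angle to `u j` becomes a coordinate of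
the new central angles. By symmetry of f these stay in the sublevel set, hence close to a point of
`V`. -/
theorem circleAngle_mem_closeAngles {d : ℕ} {f : (Fin (d + 1) → Circle) → EReal}
    {h : (Fin d → ℝ) → EReal} (hrot : ∀ u, f u = h (centralAngle u))
    (hsymm : ∀ (σ : Equiv.Perm (Fin (d + 1))) (u : Fin (d + 1) → Circle), f (u ∘ σ) = f u)
    {μ s ρ : ℝ} {V : Finset (Fin d → ℝ)}
    (hV : ∀ y ∈ angleSublevel h μ s, ∃ v ∈ V, ‖y - v‖ ≤ ρ)
    {u : Fin (d + 1) → Circle} (hu : centralAngle u ∈ angleSublevel h μ s)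
    {i j : Fin (d + 1)} (hij : i ≠ j) : circleAngle (u i) (u j) ∈ closeAngles V ρ := by
  set σ : Equiv.Perm (Fin (d + 1)) := Equiv.swap 0 i with hσ
  have hj : σ j ≠ 0 := by
    intro h0
    have : σ j = σ i := by rw [h0, hσ, Equiv.swap_apply_right]
    exact hij (σ.injective this).symm
  obtain ⟨l, hl⟩ := Fin.exists_succ_eq.2 hj
  have hσl : σ l.succ = j := by rw [hl, hσ, Equiv.swap_apply_self]
  have hσ0 : σ 0 = i := Equiv.swap_apply_left 0 i
  have hmem : centralAngle (u ∘ σ) ∈ angleSublevel h μ s := by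
    refine ⟨fun l => Set.Ico_subset_Icc_self (centralAngle_mem_Ico _ l), ?_⟩
    rw [← hrot, hsymm, hrot]
    exact hu.2
  obtain ⟨v, hv, hle⟩ := hV _ hmem
  have h1 : centralAngle (u ∘ σ) l = circleAngle (u i) (u j) := by
    simp only [centralAngle, circleAngle, Function.comp_apply, hσl, hσ0]
  refine Set.mem_biUnion hv (Set.mem_iUnion.2 ⟨l, ?_⟩)
  rw [mem_closedBall_iff_norm, ← h1]
  exact (norm_le_pi_norm (centralAngle (u ∘ σ) - v) l).trans hle

end CloseAngles

/-! ### Selections of sample points as dissociated events. -/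

section Dissociated

variable {Ω : Type*} [MeasurableSpace Ω] {P : Measure Ω}

/-- By Fubini: conditionally on X = x, the second event has probability at most b. -/
theorem ProbabilityTheory.IndepFun.measureReal_inter_le [IsProbabilityMeasure P] {α β : Type*} [MeasurableSpace α]
    [MeasurableSpace β] {X : Ω → α} {Y : Ω → β} (hXY : IndepFun X Y P) (hX : Measurable X)
    (hY : Measurable Y) {A : Set α} (hA : MeasurableSet A) {R : Set (α × β)}
    (hR : MeasurableSet R) {b : ℝ} (hb : 0 ≤ b)
    (hsec : ∀ x, P.map Y (Prod.mk x ⁻¹' R) ≤ ENNReal.ofReal b) :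
    P.real (X ⁻¹' A ∩ {ω | (X ω, Y ω) ∈ R}) ≤ P.real (X ⁻¹' A) * b := by
  have hmY : IsProbabilityMeasure (P.map Y) := Measure.isProbabilityMeasure_map hY.aemeasurable
  have hmX : IsProbabilityMeasure (P.map X) := Measure.isProbabilityMeasure_map hX.aemeasurable
  have hAR : MeasurableSet ((A ×ˢ Set.univ) ∩ R) := (hA.prod .univ).inter hR
  have h1 : P (X ⁻¹' A ∩ {ω | (X ω, Y ω) ∈ R}) =
      ((P.map X).prod (P.map Y)) ((A ×ˢ Set.univ) ∩ R) := by
    rw [← (indepFun_iff_map_prod_eq_prod_map_map hX.aemeasurable hY.aemeasurable).1 hXY,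
      Measure.map_apply (hX.prodMk hY) hAR]
    congr 1
    ext ω
    simp
  have h2 : P (X ⁻¹' A ∩ {ω | (X ω, Y ω) ∈ R}) ≤ P (X ⁻¹' A) * ENNReal.ofReal b := by
    rw [h1, Measure.prod_apply hAR, ← Measure.map_apply hX hA, mul_comm,
      ← lintegral_indicator_const hA]
    refine lintegral_mono fun x => ?_
    by_cases hx : x ∈ A
    · rw [Set.indicator_of_mem hx]
      refine (measure_mono ?_).trans (hsec x)
      exact Set.preimage_mono Set.inter_subset_right
    · rw [Set.indicator_of_notMem hx]
      have : Prod.mk x ⁻¹' ((A ×ˢ (Set.univ : Set β)) ∩ R) = ∅ := by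
        ext y; simp [hx]
      rw [this, measure_empty]
  calc _ ≤ (P (X ⁻¹' A) * ENNReal.ofReal b).toReal :=
        ENNReal.toReal_mono (ENNReal.mul_ne_top (measure_ne_top _ _) ENNReal.ofReal_ne_top) h2
    _ = _ := by rw [ENNReal.toReal_mul, ENNReal.toReal_ofReal hb, measureReal_def]

theorem card_orderEmbedding_fin (k n : ℕ) : Fintype.card (Fin k ↪o Fin n) = n.choose k := by
  rw [← Nat.card_eq_fintype_card, Nat.card_congr Set.powersetCard.ofFinEmbEquiv,
    Set.powersetCard.card, Nat.card_eq_fintype_card, Fintype.card_fin]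

variable {d n : ℕ} {U : Fin n → Ω → Circle}

/-- The event that the central angles of the points selected by `e` lie in `S`. -/
def angleEvent (U : Fin n → Ω → Circle) (S : Set (Fin d → ℝ)) (e : Fin (d + 1) ↪o Fin n) : Set Ω :=
  {ω | centralAngle (fun j => U (e j) ω) ∈ S}

theorem measurableSet_angleEvent (hmeas : ∀ i, Measurable (U i)) {S : Set (Fin d → ℝ)}
    (hS : MeasurableSet S) (e : Fin (d + 1) ↪o Fin n) : MeasurableSet (angleEvent U S e) :=
  (measurable_centralAngle.comp (measurable_pi_lambda _ fun j => hmeas (e j))) hS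

/-- The selections which have an index in common with `e`. -/
noncomputable def sharing (e : Fin (d + 1) ↪o Fin n) : Finset (Fin (d + 1) ↪o Fin n) :=
  {e' | ∃ i j, e i = e' j}

theorem mem_sharing {e e' : Fin (d + 1) ↪o Fin n} : e' ∈ sharing e ↔ ∃ i j, e i = e' j := by
  simp [sharing]

theorem indepFun_indicator_angleEvent (hmeas : ∀ i, Measurable (U i)) (hindep : iIndepFun U P)
    {S : Set (Fin d → ℝ)} (hS : MeasurableSet S) (e : Fin (d + 1) ↪o Fin n) :
    IndepFun ((angleEvent U S e).indicator (1 : Ω → ℝ))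
      (fun ω (e' : {e' // e' ∉ sharing e}) => (angleEvent U S e').indicator (1 : Ω → ℝ) ω) P := by
  set T : Finset (Fin n) := Finset.univ.map e.toEmbedding with hT
  have hmem : ∀ j, e j ∈ T := fun j => by simp [hT]
  have hmem' : ∀ (e' : {e' // e' ∉ sharing e}) (j), (e' : Fin (d + 1) ↪o Fin n) j ∈ Tᶜ := by
    intro e' j
    simp only [hT, Finset.mem_compl, Finset.mem_map, Finset.mem_univ, true_and, not_exists]
    intro i hi
    exact e'.2 (mem_sharing.2 ⟨i, j, hi⟩)
  have hC : MeasurableSet (centralAngle ⁻¹' S : Set (Fin (d + 1) → Circle)) :=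
    measurable_centralAngle hS
  have hφ : Measurable ((centralAngle ⁻¹' S : Set (Fin (d + 1) → Circle)).indicator
      (1 : (Fin (d + 1) → Circle) → ℝ)) := measurable_one.indicator hC
  have key := (hindep.indepFun_finset T Tᶜ disjoint_compl_right hmeas).comp
    (φ := fun x : T → Circle => (centralAngle ⁻¹' S : Set (Fin (d + 1) → Circle)).indicator
      (1 : (Fin (d + 1) → Circle) → ℝ) fun j => x ⟨e j, hmem j⟩)
    (ψ := fun (x : (Tᶜ : Finset (Fin n)) → Circle) (e' : {e' // e' ∉ sharing e}) =>
      (centralAngle ⁻¹' S : Set (Fin (d + 1) → Circle)).indicator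
      (1 : (Fin (d + 1) → Circle) → ℝ) fun j => x ⟨e'.1 j, hmem' e' j⟩)
    (hφ.comp (measurable_pi_lambda _ fun j => measurable_pi_apply _))
    (measurable_pi_lambda _ fun e' =>
      hφ.comp (measurable_pi_lambda _ fun j => measurable_pi_apply _))
  exact key

/-- Ranges have equal size and an increasing map is determined by its range, so a different
selection must contain a fresh index. -/
theorem OrderEmbedding.exists_notMem_range_of_ne {e e' : Fin (d + 1) ↪o Fin n} (hne : e' ≠ e) :
    ∃ k, e' k ∉ Set.range e := by
  by_contra hcon
  push Not at hcon
  refine hne (OrderEmbedding.range_inj.1 ?_)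
  refine Set.eq_of_subset_of_ncard_le (Set.range_subset_iff.2 hcon) ?_ (Set.toFinite _)
  rw [Set.ncard_range_of_injective e.injective, Set.ncard_range_of_injective e'.injective]

theorem indepFun_selection (hmeas : ∀ i, Measurable (U i)) (hindep : iIndepFun U P)
    (e : Fin (d + 1) ↪o Fin n) {k : Fin n} (hk : k ∉ Set.range e) :
    IndepFun (fun ω j => U (e j) ω) (U k) P := by
  have hmem : ∀ j, e j ∈ Finset.univ.map e.toEmbedding := fun j => by simp
  have hkT : Disjoint (Finset.univ.map e.toEmbedding) {k} := by simpa using hk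
  have hφ : Measurable fun (x : Finset.univ.map e.toEmbedding → Circle) (j : Fin (d + 1)) =>
      x ⟨e j, hmem j⟩ := measurable_pi_lambda _ fun j => measurable_pi_apply _
  have hψ : Measurable fun x : ({k} : Finset (Fin n)) → Circle =>
      x ⟨k, Finset.mem_singleton_self k⟩ := measurable_pi_apply _
  exact (hindep.indepFun_finset _ {k} hkT hmeas).comp hφ hψ

variable [IsProbabilityMeasure P] {p : ℝ → ℝ}

theorem measureReal_angleEvent_inter_le (hmeas : ∀ i, Measurable (U i)) (hindep : iIndepFun U P)
    (hlaw : ∀ i, P.map (U i) = circleLaw p) {S : Set (Fin d → ℝ)} (hS : MeasurableSet S)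
    {B : Set ℝ} (hB : MeasurableSet B) {b : ℝ} (hb : 0 ≤ b)
    (hBb : ∀ z, circleLaw p {y | circleAngle z y ∈ B} ≤ ENNReal.ofReal b)
    (e : Fin (d + 1) ↪o Fin n) (i : Fin (d + 1)) {k : Fin n} (hk : k ∉ Set.range e) :
    P.real (angleEvent U S e ∩ {ω | circleAngle (U (e i) ω) (U k ω) ∈ B}) ≤
      P.real (angleEvent U S e) * b := by
  have hX : Measurable fun ω j => U (e j) ω := measurable_pi_lambda _ fun j => hmeas _
  have hR : MeasurableSet {z : (Fin (d + 1) → Circle) × Circle | circleAngle (z.1 i) z.2 ∈ B} := by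
    have h1 : Measurable fun z : (Fin (d + 1) → Circle) × Circle => (z.1 i, z.2) := by fun_prop
    have h2 := measurable_circleAngle.comp h1
    exact h2 hB
  have hsec : ∀ x : Fin (d + 1) → Circle, P.map (U k) (Prod.mk x ⁻¹'
      {z : (Fin (d + 1) → Circle) × Circle | circleAngle (z.1 i) z.2 ∈ B}) ≤
      ENNReal.ofReal b := fun x => by
    rw [hlaw]
    exact hBb (x i)
  have key := (indepFun_selection hmeas hindep e hk).measureReal_inter_le hX (hmeas k)
    (measurable_centralAngle hS) hR hb hsec
  exact key

theorem measureReal_circleAngle_mem_le (hmeas : ∀ i, Measurable (U i)) (hindep : iIndepFun U P)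
    (hlaw : ∀ i, P.map (U i) = circleLaw p)
    {B : Set ℝ} (hB : MeasurableSet B) {b : ℝ} (hb : 0 ≤ b)
    (hBb : ∀ z, circleLaw p {y | circleAngle z y ∈ B} ≤ ENNReal.ofReal b)
    {i k : Fin n} (hik : i ≠ k) :
    P.real {ω | circleAngle (U i ω) (U k ω) ∈ B} ≤ b := by
  have := IndepFun.measureReal_inter_le (hindep.indepFun hik) (hmeas i) (hmeas k)
    (A := Set.univ) .univ (R := {z | circleAngle z.1 z.2 ∈ B}) (measurable_circleAngle hB) hb
    fun x => by rw [hlaw]; exact hBb x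
  simpa using this

/-- Poisson approximation for the number of selections whose central angles lie in `S`. -/
theorem abs_measure_no_angleEvent_sub_exp_le (hd : 1 ≤ d) (hp : Continuous p)
    (hp0 : ∀ x, 0 ≤ p x) (hper : Function.Periodic p (2 * Real.pi))
    (hp1 : ∫ x in (0 : ℝ)..(2 * Real.pi), p x = 1)
    (hmeas : ∀ i, Measurable (U i)) (hindep : iIndepFun U P)
    (hlaw : ∀ i, P.map (U i) = circleLaw p) {S : Set (Fin d → ℝ)} (hS : MeasurableSet S)
    {B : Set ℝ} (hB : MeasurableSet B) {b : ℝ} (hb : 0 ≤ b)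
    (hBb : ∀ z, circleLaw p {y | circleAngle z y ∈ B} ≤ ENNReal.ofReal b)
    (hclose : ∀ u : Fin (d + 1) → Circle, centralAngle u ∈ S →
      ∀ i j, i ≠ j → circleAngle (u i) (u j) ∈ B) :
    |P.real (⋃ e, angleEvent U S e)ᶜ -
        Real.exp (-(n.choose (d + 1) * ∫ y in S ∩ angleIcoCube d, shiftIntegral p y))| ≤
      n.choose (d + 1) * (∫ y in S ∩ angleIcoCube d, shiftIntegral p y) *
        (2 * ((d + 1) * (n * b))) := by
  classical
  set q := ∫ y in S ∩ angleIcoCube d, shiftIntegral p y with hq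
  have hprob : ∀ e, P.real (angleEvent U S e) = q := fun e =>
    measureReal_centralAngle_mem hp hp0 hper hp1 hS hmeas hindep hlaw e.injective
  have hmain := abs_measure_avoid_sub_exp_le (P := P) (E := angleEvent U S)
    (measurableSet_angleEvent hmeas hS) sharing (fun e => mem_sharing.2 ⟨0, 0, rfl⟩)
    (indepFun_indicator_angleEvent hmeas hindep hS)
  have hcardsum : ∑ _e : Fin (d + 1) ↪o Fin n, q = n.choose (d + 1) * q := by
    rw [Finset.sum_const, Finset.card_univ, card_orderEmbedding_fin, nsmul_eq_mul]
  simp only [hprob, hcardsum] at hmain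
  refine hmain.trans ?_
  -- An overlapping e' ≠ e has an index outside e, and the angle from the shared point to this fresh
  -- point lies in B. The union bound runs over at most (d + 1) n pairs.
  have hfirst : ∀ e : Fin (d + 1) ↪o Fin n,
      P.real (angleEvent U S e ∩ ⋃ e' ∈ (sharing e).erase e, angleEvent U S e') ≤
        q * ((d + 1) * (n * b)) := by
    intro e
    calc _ ≤ P.real (⋃ i : Fin (d + 1), ⋃ k : {k // k ∉ Set.range e},
          angleEvent U S e ∩ {ω | circleAngle (U (e i) ω) (U k ω) ∈ B}) := by
          refine measureReal_mono ?_
          rintro ω ⟨h1, h2⟩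
          simp only [Set.mem_iUnion, exists_prop, Finset.mem_erase] at h2
          obtain ⟨e', ⟨hne, hsh⟩, hω⟩ := h2
          obtain ⟨i, j, hij⟩ := mem_sharing.1 hsh
          obtain ⟨k, hk⟩ := OrderEmbedding.exists_notMem_range_of_ne hne
          have hjk : j ≠ k := by
            rintro rfl
            exact hk ⟨i, hij⟩
          refine Set.mem_iUnion.2 ⟨i, Set.mem_iUnion.2 ⟨⟨e' k, hk⟩, h1, ?_⟩⟩
          have := hclose _ hω j k hjk
          simpa only [Set.mem_ofPred_eq, hij] using this
      _ ≤ ∑ i : Fin (d + 1), ∑ k : {k // k ∉ Set.range e}, P.real (angleEvent U S e ∩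
          {ω | circleAngle (U (e i) ω) (U k ω) ∈ B}) :=
          (measureReal_iUnion_fintype_le _).trans
            (Finset.sum_le_sum fun i _ => measureReal_iUnion_fintype_le _)
      _ ≤ ∑ i : Fin (d + 1), ∑ k : {k // k ∉ Set.range e}, q * b := by
          refine Finset.sum_le_sum fun i _ => Finset.sum_le_sum fun k _ => ?_
          rw [← hprob e]
          exact measureReal_angleEvent_inter_le hmeas hindep hlaw hS hB hb hBb e i k.2
      _ ≤ q * ((d + 1) * (n * b)) := by
          have hq0 : 0 ≤ q := by rw [← hprob e]; exact measureReal_nonneg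
          have hcard : (Fintype.card {k // k ∉ Set.range e} : ℝ) ≤ n := by
            have := Fintype.card_subtype_le fun k => k ∉ Set.range e
            rw [Fintype.card_fin] at this
            exact_mod_cast this
          simp only [Finset.sum_const, Finset.card_univ, nsmul_eq_mul, Fintype.card_fin]
          push_cast
          calc _ ≤ ((d : ℝ) + 1) * (n * (q * b)) := by gcongr
            _ = _ := by ring
  -- Here e' may equal e, so the second index is only required to differ from the shared one; it
  -- exists because m ≥ 2.
  have hsecond : ∀ e : Fin (d + 1) ↪o Fin n,
      P.real (⋃ e' ∈ sharing e, angleEvent U S e') ≤ (d + 1) * (n * b) := by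
    intro e
    calc _ ≤ P.real (⋃ i : Fin (d + 1), ⋃ k : {k // e i ≠ k},
          {ω | circleAngle (U (e i) ω) (U k ω) ∈ B}) := by
          refine measureReal_mono ?_
          intro ω h2
          simp only [Set.mem_iUnion, exists_prop] at h2
          obtain ⟨e', hsh, hω⟩ := h2
          obtain ⟨i, j, hij⟩ := mem_sharing.1 hsh
          have hnt : Nontrivial (Fin (d + 1)) := Fin.nontrivial_iff_two_le.2 (by omega)
          obtain ⟨k, hk⟩ := exists_ne j
          refine Set.mem_iUnion.2 ⟨i, Set.mem_iUnion.2 ⟨⟨e' k, ?_⟩, ?_⟩⟩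
          · rw [hij]
            exact fun heq => hk (e'.injective heq).symm
          · have := hclose _ hω j k hk.symm
            simpa only [Set.mem_ofPred_eq, hij] using this
      _ ≤ ∑ i : Fin (d + 1), ∑ k : {k // e i ≠ k},
          P.real {ω | circleAngle (U (e i) ω) (U k ω) ∈ B} :=
          (measureReal_iUnion_fintype_le _).trans
            (Finset.sum_le_sum fun i _ => measureReal_iUnion_fintype_le _)
      _ ≤ ∑ i : Fin (d + 1), ∑ k : {k // e i ≠ k}, b :=
          Finset.sum_le_sum fun i _ => Finset.sum_le_sum fun k _ =>
            measureReal_circleAngle_mem_le hmeas hindep hlaw hB hb hBb k.2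
      _ ≤ ∑ i : Fin (d + 1), n * b := by
          refine Finset.sum_le_sum fun i _ => ?_
          have hcard : (Fintype.card {k // e i ≠ k} : ℝ) ≤ n := by
            have := Fintype.card_subtype_le fun k => e i ≠ k
            rw [Fintype.card_fin] at this
            exact_mod_cast this
          rw [Finset.sum_const, Finset.card_univ, nsmul_eq_mul]
          gcongr
      _ = (d + 1) * (n * b) := by simp
  have hq0 : ∀ e : Fin (d + 1) ↪o Fin n, 0 ≤ q := fun e => by
    rw [← hprob e]; exact measureReal_nonneg
  -- Both error terms of the Poisson bound obey the same estimate, hence the factor 2.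
  calc _ ≤ ∑ _e : Fin (d + 1) ↪o Fin n, q * (2 * ((d + 1) * (n * b))) := by
        refine Finset.sum_le_sum fun e _ => ?_
        have := mul_le_mul_of_nonneg_left (hsecond e) (hq0 e)
        linarith [hfirst e]
    _ = _ := by rw [← Finset.sum_mul, hcardsum]

end Dissociated

/-! ### Scaling and elementary limits. -/

section Limit

theorem EReal.coe_mul_sub_le_iff {A : ℝ} (hA : 0 < A) (x : EReal) (μ t : ℝ) :
    (A : EReal) * (x - (μ : EReal)) ≤ (t : EReal) ↔ x ≤ ((μ + t / A : ℝ) : EReal) := by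
  induction x with
  | bot => simp [EReal.coe_mul_bot_of_pos hA]
  | top =>
    rw [EReal.top_sub_coe, EReal.coe_mul_top_of_pos hA]
    exact iff_of_false (not_le.2 (EReal.coe_lt_top _)) (not_le.2 (EReal.coe_lt_top _))
  | coe x =>
    rw [← EReal.coe_sub, ← EReal.coe_mul, EReal.coe_le_coe_iff, EReal.coe_le_coe_iff,
      ← sub_le_iff_le_add', le_div_iff₀ hA, mul_comm]

/-- A finite infimum is attained; over an empty index type it is ⊤, which is below no real number.
-/
theorem iInf_le_coe_iff {ι : Type*} [Finite ι] (φ : ι → EReal) (z : ℝ) :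
    ⨅ i, φ i ≤ (z : EReal) ↔ ∃ i, φ i ≤ (z : EReal) := by
  constructor
  · intro h
    rcases isEmpty_or_nonempty ι with he | hne
    · rw [iInf_of_empty] at h
      exact absurd h (not_le.2 (EReal.coe_lt_top z))
    · obtain ⟨i, hi⟩ := exists_eq_ciInf_of_finite (f := φ)
      exact ⟨i, hi ▸ h⟩
  · rintro ⟨i, hi⟩
    exact (iInf_le φ i).trans hi

/-- The scale on which the central angles of minimizing selections are close to the minimum
points. -/
noncomputable def angleScale (d : ℕ) (t : ℝ) (n : ℕ) : ℝ :=
  √t * (n : ℝ) ^ (-(((d : ℝ) + 1) / d))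

variable {d : ℕ} {t : ℝ}

theorem angleScale_pos (ht : 0 < t) {n : ℕ} (hn : 0 < n) : 0 < angleScale d t n := by
  have : (0 : ℝ) < n := by exact_mod_cast hn
  unfold angleScale
  positivity

/-- Matches the threshold μ + s² with the normalisation n^{2m/(m-1)}. -/
theorem angleScale_sq (ht : 0 < t) {n : ℕ} (hn : 0 < n) :
    angleScale d t n ^ 2 = t / (n : ℝ) ^ (2 * ((d : ℝ) + 1) / (d : ℝ)) := by
  have : (0 : ℝ) < n := by exact_mod_cast hn
  rw [angleScale, mul_pow, Real.sq_sqrt ht.le, ← Real.rpow_natCast, ← Real.rpow_mul this.le,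
    div_eq_mul_inv t, ← Real.rpow_neg this.le]
  congr 2
  push_cast
  ring

/-- About n^{d+1} selections, each succeeding with probability of order s^d: the expected number of
successes stays bounded. -/
theorem angleScale_pow (hd : 1 ≤ d) (ht : 0 < t) {n : ℕ} (hn : 0 < n) :
    (n : ℝ) ^ (d + 1) * angleScale d t n ^ d = t ^ ((d : ℝ) / 2) := by
  have hn' : (0 : ℝ) < n := by exact_mod_cast hn
  have hd' : (d : ℝ) ≠ 0 := by positivity
  have h1 : √t ^ d = t ^ ((d : ℝ) / 2) := by
    rw [Real.sqrt_eq_rpow, ← Real.rpow_natCast, ← Real.rpow_mul ht.le]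
    congr 1; ring
  have h2 : ((n : ℝ) ^ (-(((d : ℝ) + 1) / d))) ^ d = ((n : ℝ) ^ (d + 1))⁻¹ := by
    rw [← Real.rpow_natCast, ← Real.rpow_mul hn'.le, ← Real.rpow_natCast, ← Real.rpow_neg hn'.le]
    congr 1
    push_cast
    field_simp
  rw [angleScale, mul_pow, h1, h2]
  field_simp

/-- n s = √t · n^{-1/d} is the order of the relative error in the Poisson approximation. -/
theorem tendsto_mul_angleScale (hd : 1 ≤ d) (t : ℝ) :
    Tendsto (fun n : ℕ => (n : ℝ) * angleScale d t n) atTop (𝓝 0) := by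
  have hd' : (0 : ℝ) < d := by positivity
  have h1 : Tendsto (fun n : ℕ => √t * (n : ℝ) ^ (-(1 / (d : ℝ)))) atTop (𝓝 (√t * 0)) :=
    ((tendsto_rpow_neg_atTop (by positivity)).comp tendsto_natCast_atTop_atTop).const_mul _
  rw [mul_zero] at h1
  refine h1.congr' ?_
  filter_upwards [eventually_gt_atTop 0] with n hn
  have hn' : (0 : ℝ) < n := by exact_mod_cast hn
  have : (n : ℝ) * (n : ℝ) ^ (-(((d : ℝ) + 1) / d)) = (n : ℝ) ^ (-(1 / (d : ℝ))) := by
    rw [← Real.rpow_one_add' hn'.le]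
    · congr 1; field_simp; ring
    · have : 1 + -(((d : ℝ) + 1) / d) = -(1 / d) := by field_simp; ring
      rw [this]
      exact neg_ne_zero.2 (by positivity)
  rw [angleScale, ← this]
  ring

theorem tendsto_angleScale (hd : 1 ≤ d) (ht : 0 < t) :
    Tendsto (angleScale d t) atTop (𝓝[>] 0) := by
  refine tendsto_nhdsWithin_iff.2 ⟨?_, ?_⟩
  · refine squeeze_zero' ?_ ?_ (tendsto_mul_angleScale hd t)
    · filter_upwards [eventually_gt_atTop 0] with n hn
      exact (angleScale_pos ht hn).le
    · filter_upwards [eventually_gt_atTop 0] with n hn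
      have : (1 : ℝ) ≤ n := by exact_mod_cast hn
      exact le_mul_of_one_le_left (angleScale_pos ht hn).le this
  · filter_upwards [eventually_gt_atTop 0] with n hn
    exact angleScale_pos ht hn

theorem tendsto_choose_div_pow (k : ℕ) :
    Tendsto (fun n : ℕ => (n.choose k : ℝ) / (n : ℝ) ^ k) atTop (𝓝 (1 / (k.factorial : ℝ))) := by
  have h := (isEquivalent_choose k).div
    (Asymptotics.IsEquivalent.refl (u := fun n : ℕ => (n : ℝ) ^ k) (l := atTop))
  refine (Asymptotics.IsEquivalent.tendsto_nhds_iff h).2 ?_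
  refine tendsto_const_nhds.congr' ?_
  filter_upwards [eventually_gt_atTop 0] with n hn
  have hn' : (0 : ℝ) < n := by exact_mod_cast hn
  simp only [Pi.div_apply]
  field_simp

end Limit

/-! ### The limit theorem. -/

/-- The degree of the kernel is `m = d + 1 ≥ 2`. -/
theorem corollary4p1 {d : ℕ} (hd : 1 ≤ d)
    -- the kernel `f`, the function `h` of the central angles, its minimum `μ` and minimum points
    (f : (Fin (d + 1) → Circle) → EReal) (h : (Fin d → ℝ) → EReal)
    (μ : ℝ) (V : Finset (Fin d → ℝ))
    -- `f` depends only on the central angles, that is, `f` is invariant under rotations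
    (hrot : ∀ u, f u = h (centralAngle u))
    -- `f` is symmetric
    (hsymm : ∀ (σ : Equiv.Perm (Fin (d + 1))) (u : Fin (d + 1) → Circle), f (u ∘ σ) = f u)
    -- `h` is continuous on `[0, 2π)^{m-1}` and extended continuously to `[0, 2π]^{m-1}`
    (hcont : ContinuousOn h (angleCube d))
    -- `μ` is the minimum of `h`, attained exactly at the points of the finite set `V`,
    -- all of which are interior
    (hmin : IsLeast (h '' angleCube d) (μ : EReal))
    (hV : ∀ x ∈ angleCube d, h x = (μ : EReal) ↔ x ∈ V)
    (hVint : ∀ v ∈ V, ∀ l, v l ∈ Set.Ioo 0 (2 * Real.pi))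
    -- near the minimum points `h` is finite and three times continuously differentiable
    (hsmooth : ∃ δ > 0, ∀ v ∈ V, (∀ x ∈ Metric.ball v δ, h x ≠ ⊤ ∧ h x ≠ ⊥) ∧
      ContDiffOn ℝ 3 (fun x => (h x).toReal) (Metric.ball v δ))
    -- the Hessian matrices at the minimum points are nondegenerate
    (hdet : ∀ v ∈ V, (hessianMatrix (fun x => (h x).toReal) v).det ≠ 0)
    -- the density `p`
    (p : ℝ → ℝ) (hp : Continuous p) (hp0 : ∀ x, 0 ≤ p x)
    (hper : Function.Periodic p (2 * Real.pi))
    (hp1 : ∫ x in (0 : ℝ)..(2 * Real.pi), p x = 1)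
    (hpV : ∃ v ∈ V, shiftIntegral p v ≠ 0)
    -- independent random points on the circle with density `p`
    {Ω : Type*} [MeasurableSpace Ω] (P : Measure Ω) [IsProbabilityMeasure P]
    (U : ℕ → Ω → Circle) (hmeas : ∀ i, Measurable (U i)) (hindep : iIndepFun U P)
    (hlaw : ∀ i, P.map (U i) = circleLaw p)
    (t : ℝ) (ht : 0 < t) :
    Tendsto
      (fun n : ℕ => P.real {ω |
        (((n : ℝ) ^ (2 * ((d : ℝ) + 1) / (d : ℝ)) : ℝ) : EReal) *
          (uMin f n (fun i => U i ω) - (μ : EReal)) ≤ (t : EReal)})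
      atTop
      (𝓝 (1 - Real.exp (-(t ^ ((d : ℝ) / 2) *
        limitConstant (fun x => (h x).toReal) V p / ((d + 1).factorial : ℝ))))) := by
  obtain ⟨C, hC, hsub⟩ := exists_eventually_angleSublevel_subset_closedBall hcont hmin hV hVint
    hsmooth hdet
  obtain ⟨K, hK, hKb⟩ := exists_circleLaw_closeAngles_le V hp hper
  set s := angleScale d t with hs
  set c := limitConstant (fun x => (h x).toReal) V p with hc
  -- Λ n is the expected number of successful selections and q n the probability that there is none.
  set Λ : ℕ → ℝ := fun n => n.choose (d + 1) *
    ∫ y in angleSublevel h μ (s n) ∩ angleIcoCube d, shiftIntegral p y with hΛ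
  set q : ℕ → ℝ := fun n => P.real (⋃ e, angleEvent (fun i : Fin n => U i)
    (angleSublevel h μ (s n)) e)ᶜ with hq
  have hstend := tendsto_angleScale (d := d) hd ht
  have hSmeas : ∀ n, MeasurableSet (angleSublevel h μ (s n)) := fun n =>
    (isClosed_angleSublevel hcont _).measurableSet
  have hΛlim : Tendsto Λ atTop (𝓝 (t ^ ((d : ℝ) / 2) * c / ((d + 1).factorial : ℝ))) := by
    have h1 := (tendsto_setIntegral_angleSublevel hd hcont hmin hV hVint hsmooth hdet hp).comp
      hstend
    have h2 := ((tendsto_choose_div_pow (d + 1)).mul_const (t ^ ((d : ℝ) / 2))).mul h1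
    have hval : 1 / ((d + 1).factorial : ℝ) * t ^ ((d : ℝ) / 2) * c =
        t ^ ((d : ℝ) / 2) * c / ((d + 1).factorial : ℝ) := by ring
    rw [← hval]
    refine h2.congr' ?_
    filter_upwards [eventually_gt_atTop 0] with n hn
    have hn' : (0 : ℝ) < n := by exact_mod_cast hn
    have hsn : 0 < s n := angleScale_pos ht hn
    rw [← angleScale_pow hd ht hn, Function.comp_apply]
    simp only [hΛ, ← hs]
    field_simp
  have herr : Tendsto (fun n => Λ n * (2 * (((d : ℝ) + 1) * (n * (K * (C * s n)))))) atTop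
      (𝓝 0) := by
    have h1 := hΛlim.mul ((tendsto_mul_angleScale hd t).const_mul (2 * (((d : ℝ) + 1) * (K * C))))
    rw [mul_zero, mul_zero] at h1
    refine h1.congr fun n => ?_
    rw [← hs]
    ring
  -- The Poisson bound is applied with B = `closeAngles V (C * s n)` and b = K (C s n).
  have hdiff : Tendsto (fun n => q n - Real.exp (-Λ n)) atTop (𝓝 0) := by
    refine squeeze_zero_norm' ?_ herr
    filter_upwards [hstend.eventually hsub, eventually_gt_atTop 0] with n hsn hn
    have hρ : 0 ≤ C * s n := mul_nonneg hC.le (angleScale_pos ht hn).le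
    exact abs_measure_no_angleEvent_sub_exp_le hd hp hp0 hper hp1 (fun i => hmeas i)
      (hindep.precomp Fin.val_injective) (fun i => hlaw i) (hSmeas n)
      (measurableSet_closeAngles V (C * s n)) (mul_nonneg hK hρ) (hKb _)
      fun u hu i j hij => circleAngle_mem_closeAngles hrot hsymm hsn hu hij
  have hqlim : Tendsto q atTop
      (𝓝 (Real.exp (-(t ^ ((d : ℝ) / 2) * c / ((d + 1).factorial : ℝ))))) := by
    have := hdiff.add ((Real.continuous_exp.tendsto _).comp hΛlim.neg)
    simpa using this
  refine (hqlim.const_sub 1).congr' ?_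
  filter_upwards [eventually_gt_atTop 0] with n hn
  have hn' : (0 : ℝ) < n := by exact_mod_cast hn
  have hEmeas : MeasurableSet (⋃ e, angleEvent (fun i : Fin n => U i)
      (angleSublevel h μ (s n)) e) :=
    .iUnion fun e => measurableSet_angleEvent (fun i => hmeas i) (hSmeas n) e
  simp only [hq]
  rw [probReal_compl_eq_one_sub hEmeas, sub_sub_cancel]
  congr 1
  ext ω
  -- The normalised event is the union of the angle events; membership in the cube is automatic for
  -- central angles.
  rw [Set.mem_ofPred_eq, EReal.coe_mul_sub_le_iff (by positivity), ← angleScale_sq ht hn, uMin,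
    iInf_le_coe_iff, Set.mem_iUnion]
  refine exists_congr fun e => ?_
  rw [hrot]
  exact ⟨fun h1 => h1.2, fun h1 =>
    ⟨fun l => Set.Ico_subset_Icc_self (centralAngle_mem_Ico _ l), h1⟩⟩
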